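/- **Theorem 2.1.** Let $H$ be a separable complex Hilbert space, $A:D(A)\subset H\to H$ a linear self-adjoint (possibly unbounded) operator, and $a<b$ real numbers. Inner products are linear in the first argument. For $J=(-\infty,a)$ and $J=(b,+\infty)$ let $L_{10}$ and $L_{20}$, respectively, be the minimal operator generated by $i\frac{d}{dt}+A$ in $L^2(H,J)$, i.e. the closure of the operator $u\mapsto iu'+Au$ defined on the finite sums $u(t)=\sum_k\varphi_k(t)f_k$ with $\varphi_k\in C_0^\infty(J)$ and $f_k\in D(A)$. Let $L_0=L_{10}\oplus L_{20}$ in $L^2=L^2(H,(-\infty,a))\oplus L^2(H,(b,+\infty))$. Every $u=(u_1,u_2)\in D(L_0^*)$ has representatives $u_1$, $u_2$ that are continuous in $H$ on $(-\infty,a]$ and on $[b,+\infty)$, respectively; their values $u_1(a),u_2(b)\in H$ are uniquely determined and depend linearly on $u$. The triplet $(H,\gamma_1,\gamma_2)$ with the linear maps $\gamma_1,\gamma_2:D(L_0^*)\to H$, $$\gamma_1(u)=\frac{i}{\sqrt2}\,\bigl(u_1(a)+u_2(b)\bigr),\qquad \gamma_2(u)=\frac1{\sqrt2}\,\bigl(u_1(a)-u_2(b)\bigr),$$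 is a space of boundary values (boundary triplet) for the minimal operator $L_0$. That is, $L_0$ is a closed densely defined symmetric operator with equal deficiency indices; for all $u,v\in D(L_0^*)$ $$(L_0^*u,v)_{L^2}-(u,L_0^*v)_{L^2}=(\gamma_1(u),\gamma_2(v))_H-(\gamma_2(u),\gamma_1(v))_H;$$ and for all $F_1,F_2\in H$ there is $u\in D(L_0^*)$ with $\gamma_1(u)=F_1$ and $\gamma_2(u)=F_2$. -/

import Mathlib

open MeasureTheory Set
open scoped ContDiff LinearPMap

noncomputable section

namespace MultipointOperator

variable {E F G H : Type*}
  [NormedAddCommGroup E] [InnerProductSpace ℂ E]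
  [NormedAddCommGroup F] [InnerProductSpace ℂ F]
  [NormedAddCommGroup G] [InnerProductSpace ℂ G]
  [NormedAddCommGroup H] [InnerProductSpace ℂ H]

/-! ### Abstract notions -/

/-- The orthogonal direct sum `S ⊕ T` of two partially defined operators, on the Hilbert space
direct sum `E ⊕ F`; its domain is `D(S) ⊕ D(T)`. -/
def directSum (S : E →ₗ.[ℂ] E) (T : F →ₗ.[ℂ] F) :
    WithLp 2 (E × F) →ₗ.[ℂ] WithLp 2 (E × F) where
  domain :=
    { carrier := {u | u.fst ∈ S.domain ∧ u.snd ∈ T.domain}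
      add_mem' := fun hu hv => ⟨S.domain.add_mem hu.1 hv.1, T.domain.add_mem hu.2 hv.2⟩
      zero_mem' := ⟨S.domain.zero_mem, T.domain.zero_mem⟩
      smul_mem' := fun c _ hu => ⟨S.domain.smul_mem c hu.1, T.domain.smul_mem c hu.2⟩ }
  toFun :=
    { toFun := fun u => WithLp.toLp 2 (S ⟨u.1.fst, u.2.1⟩, T ⟨u.1.snd, u.2.2⟩)
      map_add' := fun u v => by
        have h1 := S.map_add ⟨u.1.fst, u.2.1⟩ ⟨v.1.fst, v.2.1⟩
        have h2 := T.map_add ⟨u.1.snd, u.2.2⟩ ⟨v.1.snd, v.2.2⟩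
        rw [← WithLp.toLp_add, Prod.mk_add_mk, ← h1, ← h2]
        rfl
      map_smul' := fun c u => by
        have h1 := S.map_smul c ⟨u.1.fst, u.2.1⟩
        have h2 := T.map_smul c ⟨u.1.snd, u.2.2⟩
        rw [RingHom.id_apply, ← WithLp.toLp_smul, Prod.smul_mk, ← h1, ← h2]
        rfl }

/-- The space `ker (B - z)`. -/
def eigenspace (B : E →ₗ.[ℂ] E) (z : ℂ) : Submodule ℂ E where
  carrier := {u | ∃ h : u ∈ B.domain, B ⟨u, h⟩ = z • u}
  add_mem' := by
    rintro u v ⟨hu, hu'⟩ ⟨hv, hv'⟩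
    refine ⟨B.domain.add_mem hu hv, ?_⟩
    have h := B.map_add ⟨u, hu⟩ ⟨v, hv⟩
    rw [hu', hv', ← smul_add] at h
    exact h
  zero_mem' := ⟨B.domain.zero_mem, by rw [smul_zero]; exact B.map_zero⟩
  smul_mem' := by
    rintro c u ⟨hu, hu'⟩
    refine ⟨B.domain.smul_mem c hu, ?_⟩
    have h := B.map_smul c ⟨u, hu⟩
    rw [hu', smul_comm] at h
    exact h

/-- The deficiency indices `dim ker (B* + i)` and `dim ker (B* - i)` are equal. The dimensions are
Hilbert space dimensions, so equality means that the two spaces are isometrically isomorphic. -/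
def EqualDeficiencyIndices [CompleteSpace E] (B : E →ₗ.[ℂ] E) : Prop :=
  Nonempty (eigenspace B† (-Complex.I) ≃ₗᵢ[ℂ] eigenspace B† Complex.I)

/-- `(G, γ₁, γ₂)` is a space of boundary values (boundary triplet) for `B`, where `B` is a closed
densely defined symmetric operator with equal deficiency indices.
Mathematicians' `(x, y)`, linear in `x`, is Mathlib's `inner ℂ y x`. -/
structure IsSpaceOfBoundaryValues [CompleteSpace E] (B : E →ₗ.[ℂ] E)
    (γ₁ γ₂ : B†.domain →ₗ[ℂ] G) : Prop where
  isClosed : B.IsClosed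
  dense_domain : Dense (B.domain : Set E)
  symmetric : B.IsFormalAdjoint B
  deficiency : EqualDeficiencyIndices B
  /-- `(B* f, g) - (f, B* g) = (γ₁ f, γ₂ g) - (γ₂ f, γ₁ g)` -/
  green : ∀ f g : B†.domain,
    inner ℂ (g : E) (B† f) - inner ℂ (B† g) (f : E)
      = inner ℂ (γ₂ g) (γ₁ f) - inner ℂ (γ₁ g) (γ₂ f)
  surjective : ∀ F₁ F₂ : G, ∃ f : B†.domain, γ₁ f = F₁ ∧ γ₂ f = F₂

/-! ### The differential operators -/

/-- `L²(H, J)`: square integrable `H`-valued functions on `J ⊆ ℝ`, up to equality a.e. -/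
abbrev L2 (H : Type*) [NormedAddCommGroup H] (J : Set ℝ) : Type _ :=
  Lp H 2 (volume.restrict J)

/-- The pairs `(u, i u' + A u)` for the elementary functions `u(t) = φ(t) f`,
where `φ ∈ C₀^∞(J)` is scalar valued and `f ∈ D(A)`. -/
def elementaryPairs (A : H →ₗ.[ℂ] H) (J : Set ℝ) : Set (L2 H J × L2 H J) :=
  {p | ∃ (φ : ℝ → ℂ) (f : A.domain),
    ContDiff ℝ ∞ φ ∧ HasCompactSupport φ ∧ tsupport φ ⊆ J ∧
    p.1 =ᵐ[volume.restrict J] (fun t => φ t • (f : H)) ∧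
    p.2 =ᵐ[volume.restrict J] (fun t => (Complex.I * deriv φ t) • (f : H) + φ t • A f)}

/-- The operator `u ↦ i u' + A u` on the finite sums `u(t) = ∑ φₖ(t) fₖ`,
with `φₖ ∈ C₀^∞(J)` and `fₖ ∈ D(A)`. -/
def preminimalOperator (A : H →ₗ.[ℂ] H) (J : Set ℝ) : L2 H J →ₗ.[ℂ] L2 H J :=
  (Submodule.span ℂ (elementaryPairs A J)).toLinearPMap

/-- The minimal operator generated by `i d/dt + A` in `L²(H, J)`. -/
def minimalOperator (A : H →ₗ.[ℂ] H) (J : Set ℝ) : L2 H J →ₗ.[ℂ] L2 H J :=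
  (preminimalOperator A J).closure

/-- For open `J`, the span of the elementary pairs is single valued, so that it is the graph of
`preminimalOperator A J`. -/
theorem graph_preminimalOperator (A : H →ₗ.[ℂ] H) {J : Set ℝ} (hJ : IsOpen J) :
    (preminimalOperator A J).graph = Submodule.span ℂ (elementaryPairs A J) := by
  have key : ∀ p ∈ Submodule.span ℂ (elementaryPairs A J), ∃ u : ℝ → A.domain,
      Differentiable ℝ (fun t => (u t : H)) ∧
      p.1 =ᵐ[volume.restrict J] (fun t => (u t : H)) ∧
      p.2 =ᵐ[volume.restrict J]
        (fun t => Complex.I • deriv (fun s => (u s : H)) t + A (u t)) := by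
    intro p hp
    induction hp using Submodule.span_induction with
    | mem p hp =>
      obtain ⟨φ, f, hφ, -, -, h1, h2⟩ := hp
      have hd : Differentiable ℝ φ := hφ.differentiable (by simp)
      refine ⟨fun t => φ t • f, ?_, h1, ?_⟩
      · exact hd.smul_const (f : H)
      · filter_upwards [h2] with t ht
        have := ((hd t).hasDerivAt.smul_const (f : H)).deriv
        rw [ht, mul_smul, A.map_smul]
        congr 2
        exact this.symm
    | zero =>
      refine ⟨fun _ => 0, by simp, ?_, ?_⟩
      · exact Lp.coeFn_zero H 2 (volume.restrict J)
      · filter_upwards [Lp.coeFn_zero H 2 (volume.restrict J)] with t ht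
        rw [Prod.snd_zero, ht]
        simp
    | add p q _ _ hp hq =>
      obtain ⟨u, hu, hu1, hu2⟩ := hp
      obtain ⟨v, hv, hv1, hv2⟩ := hq
      refine ⟨fun t => u t + v t, hu.add hv, ?_, ?_⟩
      · filter_upwards [hu1, hv1, Lp.coeFn_add p.1 q.1] with t h1 h2 h3
        rw [Prod.fst_add, h3, Pi.add_apply, h1, h2]
        rfl
      · filter_upwards [hu2, hv2, Lp.coeFn_add p.2 q.2] with t h1 h2 h3
        have h4 : deriv (fun s => ((u s + v s : A.domain) : H)) t
            = deriv (fun s => (u s : H)) t + deriv (fun s => (v s : H)) t :=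
          deriv_fun_add (hu t) (hv t)
        rw [Prod.snd_add, h3, Pi.add_apply, h1, h2, A.map_add, h4, smul_add]
        abel
    | smul c p _ hp =>
      obtain ⟨u, hu, hu1, hu2⟩ := hp
      refine ⟨fun t => c • u t, hu.const_smul c, ?_, ?_⟩
      · filter_upwards [hu1, Lp.coeFn_smul c p.1] with t h1 h3
        rw [Prod.smul_fst, h3, Pi.smul_apply, h1]
        rfl
      · filter_upwards [hu2, Lp.coeFn_smul c p.2] with t h1 h3
        have h4 : deriv (fun s => ((c • u s : A.domain) : H)) t
            = c • deriv (fun s => (u s : H)) t :=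
          deriv_fun_const_smul c (hu t)
        rw [Prod.smul_snd, h3, Pi.smul_apply, h1, A.map_smul, h4, smul_add, smul_comm]
  refine Submodule.toLinearPMap_graph_eq _ fun p hp hp0 => ?_
  obtain ⟨u, hu, h1, h2⟩ := key p hp
  have h0 : ∀ t ∈ J, (u t : H) = 0 := by
    have hae : (fun t => (u t : H)) =ᵐ[volume.restrict J] fun _ => (0 : H) := by
      rw [hp0] at h1
      exact h1.symm.trans (Lp.coeFn_zero H 2 (volume.restrict J))
    exact Measure.eqOn_open_of_ae_eq hae hJ hu.continuous.continuousOn continuousOn_const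
  rw [Lp.eq_zero_iff_ae_eq_zero]
  filter_upwards [h2, ae_restrict_mem hJ.measurableSet] with t ht htJ
  have hu0 : u t = 0 := Subtype.ext (h0 t htJ)
  have hev : (fun s => (u s : H)) =ᶠ[nhds t] fun _ => (0 : H) :=
    Filter.eventually_of_mem (hJ.mem_nhds htJ) h0
  rw [ht, hu0, hev.deriv_eq]
  simp

/-- The Hilbert space `L²(H, (-∞, a)) ⊕ L²(H, (b, +∞))`. -/
abbrev L2Sum (H : Type*) [NormedAddCommGroup H] (a b : ℝ) : Type _ :=
  WithLp 2 (L2 H (Iio a) × L2 H (Ioi b))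

/-- The minimal multipoint operator `L₀ = L₁₀ ⊕ L₂₀`. -/
def L₀ (A : H →ₗ.[ℂ] H) (a b : ℝ) : L2Sum H a b →ₗ.[ℂ] L2Sum H a b :=
  directSum (minimalOperator A (Iio a)) (minimalOperator A (Ioi b))

/-- `u(a) = x` for `u ∈ L²(H, (-∞, a))`: `u` has a representative that is continuous
on `(-∞, a]` with value `x` at `a`. -/
def HasLeftBoundaryValue (a : ℝ) (u : L2 H (Iio a)) (x : H) : Prop :=
  ∃ v : ℝ → H, ContinuousOn v (Iic a) ∧ v a = x ∧ u =ᵐ[volume.restrict (Iio a)] v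

/-- `u(b) = x` for `u ∈ L²(H, (b, +∞))`: `u` has a representative that is continuous
on `[b, +∞)` with value `x` at `b`. -/
def HasRightBoundaryValue (b : ℝ) (u : L2 H (Ioi b)) (x : H) : Prop :=
  ∃ v : ℝ → H, ContinuousOn v (Ici b) ∧ v b = x ∧ u =ᵐ[volume.restrict (Ioi b)] v

end MultipointOperator

end

noncomputable section

namespace MultipointOperator

open Filter Topology
open scoped ENNReal

/-! ### Mollification in `L²` -/

section Mollification

variable {X : Type*} [NormedAddCommGroup X]

/-! Both half-lines are treated at once, with a sign s = 1 for (-∞, a) and s = -1 for (b, +∞). The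
adjoint of a minimal operator consists of the pairs (u, g) with i u' + A u = g weakly
(`mem_graph_adjoint_minimalOperator_iff`). Convolving u with a kernel supported on the proper side
of 0 uses only values of u inside the half-line, even at the end point c, and gives a differentiable
function with values in D(A), because A = A* (`IsWeakPair.isStrongPair_mollify`).

For such strong solutions, symmetry of A turns (w, v)' into -i[(h, v) - (w, k)]. Integrating over a
tail gives Green's identity and, for v = w, the bound ‖w(t)‖² ≤ ‖w‖² + ‖h‖² uniformly up to c
(`IsStrongPair.norm_sq_le`). So convergence in the graph norm is uniform convergence: every weak
solution has a continuous representative, and Green's identity passes to the limit with boundary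
form s i (u(c), v(c)).

This form is definite. For S*u = r i u it reads ‖u(c)‖² = 2 s r ‖u‖². Hence ker(S* + s i) = 0, and
on ker(S* - s i) the trace is √2 times an isometry. The first fact makes S - s i surjective, so
every trace value is attained on ker(S* - s i) (`exists_eigenvector_trace_eq`). The second makes the
range of the trace closed; it contains D(A), so it is all of H (`trace_surjective`).

Consequently ker(L₀* - i) lives on the left half-line, ker(L₀* + i) on the right one, and both are
isometric to H. The two boundary values can be prescribed independently, and Green's identity for
γ₁, γ₂ is algebra. -/

theorem eLpNorm_two_sq {α : Type*} [MeasurableSpace α] (μ : Measure α) (f : α → X) :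
    eLpNorm f 2 μ ^ 2 = ∫⁻ x, ‖f x‖ₑ ^ 2 ∂μ := by
  have h := eLpNorm_nnreal_pow_eq_lintegral (f := f) (μ := μ) (p := 2) (by norm_num)
  simpa only [NNReal.coe_ofNat, ENNReal.coe_ofNat, ENNReal.rpow_ofNat] using h

theorem eLpNorm_two_le_iff {α : Type*} [MeasurableSpace α] (μ : Measure α) (f : α → X)
    (ε : ℝ≥0∞) : eLpNorm f 2 μ ≤ ε ↔ ∫⁻ x, ‖f x‖ₑ ^ 2 ∂μ ≤ ε ^ 2 := by
  rw [← eLpNorm_two_sq, ENNReal.pow_le_pow_left_iff two_ne_zero]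

/-- On a probability space the L¹ norm is at most the L² norm. -/
theorem enorm_integral_sq_le [NormedSpace ℝ X] {α : Type*} [MeasurableSpace α] (ν : Measure α)
    [IsProbabilityMeasure ν] {f : α → X} (hf : AEStronglyMeasurable f ν) :
    ‖∫ x, f x ∂ν‖ₑ ^ 2 ≤ ∫⁻ x, ‖f x‖ₑ ^ 2 ∂ν := by
  rw [← eLpNorm_two_sq]
  gcongr
  calc ‖∫ x, f x ∂ν‖ₑ ≤ ∫⁻ x, ‖f x‖ₑ ∂ν := enorm_integral_le_lintegral_enorm f
    _ = eLpNorm f 1 ν := eLpNorm_one_eq_lintegral_enorm.symm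
    _ ≤ eLpNorm f 2 ν := eLpNorm_le_eLpNorm_of_exponent_le (by norm_num) hf

/-- An average of translates of `F` is as close to `F` as the translates are. -/
theorem eLpNorm_average_translate_sub_le [NormedSpace ℝ X] [CompleteSpace X] (ν : Measure ℝ)
    [IsProbabilityMeasure ν] {F : ℝ → X} (hF : StronglyMeasurable F)
    (hint : ∀ t, Integrable (fun x => F (t - x)) ν) {ε : ℝ≥0∞}
    (hε : ∀ᵐ x ∂ν, eLpNorm (fun t => F (t - x) - F t) 2 volume ≤ ε) :
    eLpNorm (fun t => ∫ x, F (t - x) ∂ν - F t) 2 volume ≤ ε := by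
  rw [eLpNorm_two_le_iff]
  have hmeas : StronglyMeasurable (fun p : ℝ × ℝ => F (p.1 - p.2) - F p.1) :=
    (hF.comp_measurable (measurable_fst.sub measurable_snd)).sub (hF.comp_measurable measurable_fst)
  calc ∫⁻ t, ‖∫ x, F (t - x) ∂ν - F t‖ₑ ^ 2
      ≤ ∫⁻ t, ∫⁻ x, ‖F (t - x) - F t‖ₑ ^ 2 ∂ν := by
        refine lintegral_mono fun t => ?_
        have h : ∫ x, F (t - x) ∂ν - F t = ∫ x, (F (t - x) - F t) ∂ν := by
          rw [integral_sub (hint t) (integrable_const _)]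
          simp
        rw [h]
        exact enorm_integral_sq_le ν ((hint t).sub (integrable_const _)).aestronglyMeasurable
    _ = ∫⁻ x, (∫⁻ t, ‖F (t - x) - F t‖ₑ ^ 2) ∂ν :=
        lintegral_lintegral_swap (hmeas.enorm.pow_const 2).aemeasurable
    _ ≤ ∫⁻ _, ε ^ 2 ∂ν := by
        refine lintegral_mono_ae (hε.mono fun x hx => ?_)
        exact (eLpNorm_two_le_iff _ _ _).1 hx
    _ = ε ^ 2 := by simp

/-- Translations preserve Lebesgue measure and depend continuously on the shift, so they act
continuously on a fixed element of L². -/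
theorem tendsto_eLpNorm_translate_sub {F : ℝ → X} (hF : MemLp F 2 volume) :
    Tendsto (fun x => eLpNorm (fun t => F (t - x) - F t) 2 volume) (𝓝 0) (𝓝 0) := by
  have hmp : ∀ x : ℝ, MeasurePreserving (fun t : ℝ => t - x) volume volume :=
    fun x => measurePreserving_sub_right volume x
  let g : ℝ → C(ℝ, ℝ) := fun x => ⟨fun t => t - x, by fun_prop⟩
  have hg : Continuous g := ContinuousMap.continuous_of_continuous_uncurry _ (by
    change Continuous fun p : ℝ × ℝ => p.2 - p.1
    fun_prop)
  have hc := Continuous.compMeasurePreservingLp (f := fun _ : ℝ => hF.toLp F)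
    continuous_const hg hmp (by norm_num)
  have h := hc.tendsto 0
  have e : ∀ x, Lp.compMeasurePreserving (g x) (hmp x) (hF.toLp F)
      = (hF.comp_measurePreserving (hmp x)).toLp (fun t => F (t - x)) := fun x => rfl
  simp only [e] at h
  rw [Lp.tendsto_Lp_iff_tendsto_eLpNorm''] at h
  simp only [sub_zero] at h
  simpa [Pi.sub_def] using h

end Mollification

/-! ### Convolution with a smooth kernel -/

section Kernel

variable {X : Type*} [NormedAddCommGroup X] [NormedSpace ℝ X]

/-- The mollification of `F` with kernel `ρ`. -/
def mollify (ρ : ℝ → ℝ) (F : ℝ → X) (t : ℝ) : X := ∫ x, ρ x • F (t - x)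

theorem mollify_eq_integral_sub (ρ : ℝ → ℝ) (F : ℝ → X) (t : ℝ) :
    mollify ρ F t = ∫ r, ρ (t - r) • F r := by
  rw [mollify, ← integral_sub_left_eq_self _ volume t]
  simp

theorem hasDerivAt_mollify {ρ : ℝ → ℝ} (hρ : ContDiff ℝ ∞ ρ) (hc : HasCompactSupport ρ)
    {F : ℝ → X} (hF : LocallyIntegrable F) (t : ℝ) :
    HasDerivAt (mollify ρ F) (mollify (deriv ρ) F t) t :=
  hc.hasDerivAt_convolution_left (ContinuousLinearMap.lsmul ℝ ℝ) (hρ.of_le (by simp)) hF t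

theorem integrable_mollify {ρ : ℝ → ℝ} (hρ : Continuous ρ) (hc : HasCompactSupport ρ)
    {F : ℝ → X} (hF : LocallyIntegrable F) (t : ℝ) :
    Integrable (fun x => ρ x • F (t - x)) :=
  (hc.convolutionExists_left (ContinuousLinearMap.lsmul ℝ ℝ) hρ hF) t

/-- The mollification is an average of translates with respect to the probability measure ρ dx, so
`eLpNorm_average_translate_sub_le` applies. -/
theorem eLpNorm_mollify_sub_le [CompleteSpace X] {ρ : ℝ → ℝ} (hρ : Continuous ρ)
    (hc : HasCompactSupport ρ) (h0 : ∀ x, 0 ≤ ρ x) (h1 : ∫ x, ρ x = 1)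
    {F : ℝ → X} (hFm : StronglyMeasurable F)
    (hF : LocallyIntegrable F) {ε : ℝ≥0∞}
    (hε : ∀ x ∈ Function.support ρ, eLpNorm (fun t => F (t - x) - F t) 2 volume ≤ ε) :
    eLpNorm (mollify ρ F - F) 2 volume ≤ ε := by
  let ν : Measure ℝ := volume.withDensity fun x => ENNReal.ofReal (ρ x)
  have hm : Measurable fun x => ENNReal.ofReal (ρ x) := hρ.measurable.ennreal_ofReal
  have hν : IsProbabilityMeasure ν := ⟨by
    rw [withDensity_apply _ MeasurableSet.univ, Measure.restrict_univ,
      ← ofReal_integral_eq_lintegral_ofReal (hρ.integrable_of_hasCompactSupport hc)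
        (Eventually.of_forall h0), h1, ENNReal.ofReal_one]⟩
  have hfin : ∀ᵐ x, ENNReal.ofReal (ρ x) < ⊤ := Eventually.of_forall fun x => ENNReal.ofReal_lt_top
  have hint : ∀ t, Integrable (fun x => F (t - x)) ν := fun t => by
    rw [integrable_withDensity_iff_integrable_smul' hm hfin]
    simpa only [ENNReal.toReal_ofReal (h0 _)] using integrable_mollify hρ hc hF t
  have heq : ∀ t, mollify ρ F t = ∫ x, F (t - x) ∂ν := fun t => by
    rw [integral_withDensity_eq_integral_toReal_smul hm hfin]
    simp only [ENNReal.toReal_ofReal (h0 _), mollify]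
  have hε' : ∀ᵐ x ∂ν, eLpNorm (fun t => F (t - x) - F t) 2 volume ≤ ε := by
    rw [ae_withDensity_iff hm]
    refine Eventually.of_forall fun x hx => hε x fun h => hx ?_
    simp [h]
  rw [show mollify ρ F - F = fun t => ∫ x, F (t - x) ∂ν - F t from
    funext fun t => by rw [Pi.sub_apply, heq]]
  exact eLpNorm_average_translate_sub_le ν hFm hint hε'

/-- Mollification with kernels shrinking to the origin is an approximate identity in `L²`. -/
theorem tendsto_eLpNorm_mollify_sub [CompleteSpace X] {ρ : ℕ → ℝ → ℝ} (hρ : ∀ n, Continuous (ρ n))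
    (hc : ∀ n, HasCompactSupport (ρ n)) (h0 : ∀ n x, 0 ≤ ρ n x) (h1 : ∀ n, ∫ x, ρ n x = 1)
    (hs : Tendsto (fun n => Function.support (ρ n)) atTop (𝓝 (0 : ℝ)).smallSets)
    {F : ℝ → X} (hFm : StronglyMeasurable F) (hF : MemLp F 2 volume) :
    Tendsto (fun n => eLpNorm (mollify (ρ n) F - F) 2 volume) atTop (𝓝 0) := by
  rw [ENNReal.tendsto_nhds_zero]
  intro ε hε
  have h := (tendsto_eLpNorm_translate_sub hF).eventually (Iic_mem_nhds hε)
  filter_upwards [hs.eventually (eventually_smallSets_forall.2 h)] with n hn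
  exact eLpNorm_mollify_sub_le (hρ n) (hc n) (h0 n) (h1 n) hFm
    (hF.locallyIntegrable (by norm_num)) hn

theorem memLp_mollify {ρ : ℝ → ℝ} (hρ : ContDiff ℝ ∞ ρ) (hc : HasCompactSupport ρ)
    {F : ℝ → X} (hF : MemLp F 2 volume) (h : eLpNorm (mollify ρ F - F) 2 volume < ⊤) :
    MemLp (mollify ρ F) 2 volume := by
  have hcont : Continuous (mollify ρ F) := continuous_iff_continuousAt.2 fun t =>
    (hasDerivAt_mollify hρ hc (hF.locallyIntegrable (by norm_num)) t).continuousAt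
  have : MemLp (mollify ρ F - F) 2 volume :=
    ⟨hcont.aestronglyMeasurable.sub hF.1, h⟩
  simpa using this.add hF

end Kernel

section Solutions

/-! ### Half-lines -/

/-- `J` is an open half-line with end point `c`, and `K` is its closure; `s = 1` if `J` is unbounded
below and `s = -1` if it is unbounded above. -/
structure IsHalfLine (J K : Set ℝ) (c s : ℝ) : Prop where
  isOpen : IsOpen J
  end_mem : c ∈ K
  end_notMem : c ∉ J
  subset : J ⊆ K
  subset_closure : K ⊆ closure J
  shift : ∀ t ∈ K, ∀ x, 0 < s * x → t - x ∈ J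
  mul_self : s * s = 1
  ftc : ∀ f f' : ℝ → ℂ, (∀ t ∈ K, HasDerivAt f (f' t) t) → IntegrableOn f J → IntegrableOn f' J →
    ∀ t ∈ K, ∃ M ⊆ J, MeasurableSet M ∧ (t = c → M = J) ∧ ∫ r in M, f' r = s * f t

/-- For `ftc` the set M is the tail beyond t. A function that is integrable together with its
derivative tends to 0 at infinity, so only the value at t remains; s records its sign. -/
theorem isHalfLine_Iio (a : ℝ) : IsHalfLine (Iio a) (Iic a) a 1 where
  isOpen := isOpen_Iio
  end_mem := self_mem_Iic
  end_notMem := by simp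
  subset := Iio_subset_Iic_self
  subset_closure := by rw [closure_Iio]
  shift := fun t ht x hx => by
    simp only [mem_Iic, mem_Iio, one_mul] at *
    linarith
  mul_self := by norm_num
  ftc := fun f f' hd hf hf' t ht => by
    refine ⟨Iio t, Iio_subset_Iio ht, measurableSet_Iio, fun h => by rw [h], ?_⟩
    have hd' : ∀ x ∈ Iic t, HasDerivAt f (f' x) x := fun x hx => hd x (Iic_subset_Iic.2 ht hx)
    have hsub : Iic t ⊆ Iic a := Iic_subset_Iic.2 ht
    have h1 : IntegrableOn f (Iic t) :=
      ((integrableOn_Iic_iff_integrableOn_Iio (by simp)).2 hf).mono_set hsub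
    have h2 : IntegrableOn f' (Iic t) :=
      ((integrableOn_Iic_iff_integrableOn_Iio (by simp)).2 hf').mono_set hsub
    rw [← integral_Iic_eq_integral_Iio, integral_Iic_of_hasDerivAt_of_tendsto' hd' h2
      (tendsto_zero_of_hasDerivAt_of_integrableOn_Iic hd' h2 h1)]
    simp

theorem isHalfLine_Ioi (b : ℝ) : IsHalfLine (Ioi b) (Ici b) b (-1) where
  isOpen := isOpen_Ioi
  end_mem := self_mem_Ici
  end_notMem := by simp
  subset := Ioi_subset_Ici_self
  subset_closure := by rw [closure_Ioi]
  shift := fun t ht x hx => by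
    simp only [mem_Ici, mem_Ioi] at *
    linarith
  mul_self := by norm_num
  ftc := fun f f' hd hf hf' t ht => by
    have hsub : Ioi t ⊆ Ioi b := Ioi_subset_Ioi ht
    refine ⟨Ioi t, hsub, measurableSet_Ioi, fun h => by rw [h], ?_⟩
    have hd' : ∀ x ∈ Ici t, HasDerivAt f (f' x) x := fun x hx => hd x (Ici_subset_Ici.2 ht hx)
    have h1 : IntegrableOn f (Ioi t) := hf.mono_set hsub
    have h2 : IntegrableOn f' (Ioi t) := hf'.mono_set hsub
    rw [integral_Ioi_of_hasDerivAt_of_tendsto' hd' h2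
      (tendsto_zero_of_hasDerivAt_of_integrableOn_Ioi
        (fun x hx => hd' x (Ioi_subset_Ici_self hx)) h2 h1)]
    simp

theorem abs_eq_one_of_mul_self_eq_one {s : ℝ} (hs : s * s = 1) : |s| = 1 := by
  rcases mul_self_eq_one_iff.1 hs with rfl | rfl <;> simp

/-- Smooth kernels supported on one side of the origin and shrinking to it. -/
theorem exists_mollifier {s : ℝ} (hs : s * s = 1) : ∃ ρ : ℕ → ℝ → ℝ,
    (∀ n, ContDiff ℝ ∞ (ρ n)) ∧ (∀ n, HasCompactSupport (ρ n)) ∧ (∀ n x, 0 ≤ ρ n x) ∧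
    (∀ n, ∫ x, ρ n x = 1) ∧
    Tendsto (fun n => Function.support (ρ n)) atTop (𝓝 (0 : ℝ)).smallSets ∧
    ∀ n, ∀ x ∈ tsupport (ρ n), 0 < s * x := by
  have hδ : ∀ n : ℕ, 0 < 1 / ((n : ℝ) + 1) := fun n => Nat.one_div_pos_of_nat
  have hs1 := abs_eq_one_of_mul_self_eq_one hs
  -- With δ = 1/(n+1), a bump of outer radius δ centred at 2δs: on its closed support δ ≤ s x ≤ 3δ,
  -- so it misses 0 and shrinks to it.
  let B : ∀ n : ℕ, ContDiffBump (s * (2 * (1 / ((n : ℝ) + 1)))) := fun n =>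
    ⟨1 / ((n : ℝ) + 1) / 2, 1 / ((n : ℝ) + 1), half_pos (hδ n), half_lt_self (hδ n)⟩
  refine ⟨fun n => (B n).normed volume, fun n => (B n).contDiff_normed,
    fun n => (B n).hasCompactSupport_normed, fun n => (B n).nonneg_normed,
    fun n => (B n).integral_normed, ?_, fun n x hx => ?_⟩
  · rw [tendsto_smallSets_iff]
    intro U hU
    obtain ⟨ε, hε, hU⟩ := Metric.mem_nhds_iff.1 hU
    have ht : Tendsto (fun n : ℕ => 3 * (1 / ((n : ℝ) + 1))) atTop (𝓝 0) := by
      simpa using tendsto_one_div_add_atTop_nhds_zero_nat.const_mul (3 : ℝ)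
    filter_upwards [ht.eventually (gt_mem_nhds hε)] with n hn x hx
    rw [(B n).support_normed_eq, Metric.mem_ball, Real.dist_eq] at hx
    change |x - s * (2 * (1 / ((n : ℝ) + 1)))| < 1 / ((n : ℝ) + 1) at hx
    apply hU
    rw [mem_ball_zero_iff, Real.norm_eq_abs]
    have h1 : |s * (2 * (1 / ((n : ℝ) + 1)))| = 2 * (1 / ((n : ℝ) + 1)) := by
      rw [abs_mul, hs1, one_mul, abs_of_pos (mul_pos two_pos (hδ n))]
    have h2 := abs_add_le (x - s * (2 * (1 / ((n : ℝ) + 1)))) (s * (2 * (1 / ((n : ℝ) + 1))))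
    rw [sub_add_cancel, h1] at h2
    linarith
  · rw [(B n).tsupport_normed_eq, Metric.mem_closedBall, Real.dist_eq] at hx
    change |x - s * (2 * (1 / ((n : ℝ) + 1)))| ≤ 1 / ((n : ℝ) + 1) at hx
    have h1 : |s * (x - s * (2 * (1 / ((n : ℝ) + 1))))| ≤ 1 / ((n : ℝ) + 1) := by
      rwa [abs_mul, hs1, one_mul]
    have h2 := (abs_le.1 h1).1
    have h3 : s * (x - s * (2 * (1 / ((n : ℝ) + 1))))
        = s * x - (s * s) * (2 * (1 / ((n : ℝ) + 1))) := by
      ring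
    rw [h3, hs] at h2
    linarith [hδ n]

/-! ### Strong and weak solutions of `i u' + A u = g` -/

variable {H : Type*} [NormedAddCommGroup H] [InnerProductSpace ℂ H]

/-- `w` is differentiable and `i w' + A w = h` at the points of `K`. -/
def IsStrongPair (A : H →ₗ.[ℂ] H) (K : Set ℝ) (w h : ℝ → H) : Prop :=
  ∃ w' : ℝ → H, ∀ t ∈ K, HasDerivAt w (w' t) t ∧
    ∃ hw : w t ∈ A.domain, A ⟨w t, hw⟩ = h t - Complex.I • w' t

/-- `i u' + A u = g` in the weak sense. -/
def IsWeakPair (A : H →ₗ.[ℂ] H) (J : Set ℝ) (u g : L2 H J) : Prop :=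
  ∀ p ∈ elementaryPairs A J, inner ℂ p.1 g = inner ℂ p.2 u

theorem isStrongPair_smul_const {A : H →ₗ.[ℂ] H} {φ : ℝ → ℂ} (hφ : ContDiff ℝ ∞ φ)
    (f : A.domain) (K : Set ℝ) :
    IsStrongPair A K (fun t => φ t • (f : H))
      (fun t => (Complex.I * deriv φ t) • (f : H) + φ t • A f) := by
  refine ⟨fun t => deriv φ t • (f : H), fun t _ => ⟨?_, A.domain.smul_mem _ f.2, ?_⟩⟩
  · exact ((hφ.differentiable (by simp)) t).hasDerivAt.smul_const (f : H)
  · change A ⟨φ t • (f : H), _⟩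
      = (Complex.I * deriv φ t) • (f : H) + φ t • A f - Complex.I • (deriv φ t • (f : H))
    rw [← smul_smul, add_sub_cancel_left]
    exact A.map_smul (φ t) f

theorem IsStrongPair.sub {A : H →ₗ.[ℂ] H} {K : Set ℝ} {w h v k : ℝ → H}
    (hw : IsStrongPair A K w h) (hv : IsStrongPair A K v k) : IsStrongPair A K (w - v) (h - k) := by
  obtain ⟨w', hw⟩ := hw
  obtain ⟨v', hv⟩ := hv
  refine ⟨w' - v', fun t ht => ?_⟩
  obtain ⟨h1, h2, h3⟩ := hw t ht
  obtain ⟨k1, k2, k3⟩ := hv t ht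
  refine ⟨h1.sub k1, A.domain.sub_mem h2 k2, ?_⟩
  have := A.map_sub ⟨w t, h2⟩ ⟨v t, k2⟩
  rw [h3, k3] at this
  refine this.trans ?_
  simp only [Pi.sub_apply, smul_sub]
  abel

/-- The pointwise form of the Green identity. -/
theorem IsStrongPair.hasDerivAt_inner {A : H →ₗ.[ℂ] H} (hA : A.IsFormalAdjoint A) {K : Set ℝ}
    {w h v k : ℝ → H} (hw : IsStrongPair A K w h) (hv : IsStrongPair A K v k) {t : ℝ}
    (ht : t ∈ K) :
    HasDerivAt (fun r => inner ℂ (v r) (w r))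
      (-Complex.I * (inner ℂ (v t) (h t) - inner ℂ (k t) (w t))) t := by
  obtain ⟨w', hw⟩ := hw
  obtain ⟨v', hv⟩ := hv
  obtain ⟨h1, h2, h3⟩ := hw t ht
  obtain ⟨k1, k2, k3⟩ := hv t ht
  refine (k1.inner ℂ h1).congr_deriv ?_
  -- Symmetry of A, with A w and A v replaced by h - i w' and k - i v', eliminates A from the
  -- product rule.
  have hs := hA ⟨v t, k2⟩ ⟨w t, h2⟩
  rw [h3, k3] at hs
  simp only [inner_sub_left, inner_sub_right, inner_smul_left, inner_smul_right,
    Complex.conj_I] at hs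
  linear_combination (inner ℂ (v t) (w' t) + inner ℂ (v' t) (w t) : ℂ) * Complex.I_mul_I
    - Complex.I * hs

variable {J K : Set ℝ} {c s : ℝ}

/-- The Green identity on a tail of the half-line. -/
theorem IsStrongPair.green_tail (hJ : IsHalfLine J K c s) {A : H →ₗ.[ℂ] H}
    (hA : A.IsFormalAdjoint A) {w h v k : ℝ → H} (hw : IsStrongPair A K w h)
    (hv : IsStrongPair A K v k) {U G V L : L2 H J}
    (hU : U =ᵐ[volume.restrict J] w) (hG : G =ᵐ[volume.restrict J] h)
    (hV : V =ᵐ[volume.restrict J] v) (hL : L =ᵐ[volume.restrict J] k) {t : ℝ} (ht : t ∈ K) :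
    ∃ M ⊆ J, MeasurableSet M ∧ (t = c → M = J) ∧
      ∫ r in M, (inner ℂ (V r) (G r) - inner ℂ (L r) (U r))
        = s * Complex.I * inner ℂ (v t) (w t) := by
  have hi : IntegrableOn (fun r => inner ℂ (v r) (w r)) J := by
    refine (L2.integrable_inner (𝕜 := ℂ) V U).congr ?_
    filter_upwards [hU, hV] with r h1 h2
    rw [h1, h2]
  have hi' : IntegrableOn
      (fun r => -Complex.I * (inner ℂ (v r) (h r) - inner ℂ (k r) (w r))) J := by
    refine (((L2.integrable_inner (𝕜 := ℂ) V G).sub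
      (L2.integrable_inner (𝕜 := ℂ) L U)).const_mul (-Complex.I)).congr ?_
    filter_upwards [hU, hV, hG, hL] with r h1 h2 h3 h4
    rw [Pi.sub_apply, h1, h2, h3, h4]
  obtain ⟨M, hMJ, hM, hMc, hint⟩ :=
    hJ.ftc _ _ (fun t ht => hw.hasDerivAt_inner hA hv ht) hi hi' t ht
  refine ⟨M, hMJ, hM, hMc, ?_⟩
  have e : ∫ r in M, (inner ℂ (V r) (G r) - inner ℂ (L r) (U r))
      = ∫ r in M, (inner ℂ (v r) (h r) - inner ℂ (k r) (w r)) := by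
    refine integral_congr_ae ?_
    have hle := Measure.restrict_mono_set volume hMJ
    filter_upwards [hU.filter_mono (ae_mono hle), hV.filter_mono (ae_mono hle),
      hG.filter_mono (ae_mono hle), hL.filter_mono (ae_mono hle)] with r h1 h2 h3 h4
    rw [h1, h2, h3, h4]
  rw [integral_const_mul] at hint
  rw [e]
  linear_combination Complex.I * hint
    + (∫ r in M, (inner ℂ (v r) (h r) - inner ℂ (k r) (w r) : ℂ)) * Complex.I_mul_I

theorem IsStrongPair.green (hJ : IsHalfLine J K c s) {A : H →ₗ.[ℂ] H}
    (hA : A.IsFormalAdjoint A) {w h v k : ℝ → H} (hw : IsStrongPair A K w h)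
    (hv : IsStrongPair A K v k) {U G V L : L2 H J}
    (hU : U =ᵐ[volume.restrict J] w) (hG : G =ᵐ[volume.restrict J] h)
    (hV : V =ᵐ[volume.restrict J] v) (hL : L =ᵐ[volume.restrict J] k) :
    inner ℂ V G - inner ℂ L U = s * Complex.I * inner ℂ (v c) (w c) := by
  obtain ⟨M, -, -, hM, h⟩ := hw.green_tail hJ hA hv hU hG hV hL hJ.end_mem
  rw [← h, hM rfl, integral_sub (L2.integrable_inner V G) (L2.integrable_inner L U), L2.inner_def,
    L2.inner_def]

/-- Green's identity on the tail beyond t, applied to w against itself, together with 2‖U‖‖G‖ ≤ ‖U‖²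
+ ‖G‖² pointwise. The graph norm thus controls the supremum norm up to the end point. -/
theorem IsStrongPair.norm_sq_le (hJ : IsHalfLine J K c s) {A : H →ₗ.[ℂ] H}
    (hA : A.IsFormalAdjoint A) {w h : ℝ → H} (hw : IsStrongPair A K w h) {U G : L2 H J}
    (hU : U =ᵐ[volume.restrict J] w) (hG : G =ᵐ[volume.restrict J] h) {t : ℝ} (ht : t ∈ K) :
    ‖w t‖ ^ 2 ≤ ‖U‖ ^ 2 + ‖G‖ ^ 2 := by
  obtain ⟨M, hMJ, hM, -, hint⟩ := hw.green_tail hJ hA hw hU hG hU hG ht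
  have hs := abs_eq_one_of_mul_self_eq_one hJ.mul_self
  have hsq : ∀ V : L2 H J, Integrable (fun r => ‖V r‖ ^ 2) (volume.restrict J) := fun V =>
    (memLp_two_iff_integrable_sq_norm (Lp.aestronglyMeasurable V)).1 (Lp.memLp V)
  have hnorm : ∀ V : L2 H J, ∫ r in J, ‖V r‖ ^ 2 = ‖V‖ ^ 2 := fun V => by
    have h1 : (inner ℂ V V : ℂ) = ((∫ r in J, ‖V r‖ ^ 2 : ℝ) : ℂ) := by
      rw [L2.inner_def, ← integral_complex_ofReal]
      simp only [inner_self_eq_norm_sq_to_K]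
      push_cast
      rfl
    rw [inner_self_eq_norm_sq_to_K] at h1
    exact Complex.ofReal_injective (h1.symm.trans (by push_cast; rfl))
  calc ‖w t‖ ^ 2 = ‖(s : ℂ) * Complex.I * inner ℂ (w t) (w t)‖ := by
        rw [norm_mul, norm_mul, Complex.norm_real, Real.norm_eq_abs, hs, Complex.norm_I,
          inner_self_eq_norm_sq_to_K]
        simp
    _ ≤ ∫ r in M, (‖U r‖ ^ 2 + ‖G r‖ ^ 2) := by
        rw [← hint]
        refine norm_integral_le_of_norm_le (((hsq U).add (hsq G)).mono_measure
          (Measure.restrict_mono_set volume hMJ)) (Eventually.of_forall fun r => ?_)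
        · have h1 := norm_inner_le_norm (𝕜 := ℂ) (U r) (G r)
          have h2 := norm_inner_le_norm (𝕜 := ℂ) (G r) (U r)
          have h3 := norm_sub_le (inner ℂ (U r) (G r)) (inner ℂ (G r) (U r))
          nlinarith [sq_nonneg (‖U r‖ - ‖G r‖)]
    _ ≤ ∫ r in J, (‖U r‖ ^ 2 + ‖G r‖ ^ 2) :=
        setIntegral_mono_set ((hsq U).add (hsq G)) (Eventually.of_forall fun r => by positivity)
          (LE.le.eventuallyLE hMJ)
    _ = ‖U‖ ^ 2 + ‖G‖ ^ 2 := by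
        rw [integral_add (hsq U) (hsq G), hnorm, hnorm]

end Solutions

section Regularization

variable {H : Type*} [NormedAddCommGroup H] {J : Set ℝ}

/-- The extension of `u` by zero. -/
def zeroExtend (J : Set ℝ) (u : L2 H J) : ℝ → H := J.indicator u

theorem stronglyMeasurable_zeroExtend (hJ : MeasurableSet J) (u : L2 H J) :
    StronglyMeasurable (zeroExtend J u) :=
  (Lp.stronglyMeasurable u).indicator hJ

theorem memLp_zeroExtend (hJ : MeasurableSet J) (u : L2 H J) :
    MemLp (zeroExtend J u) 2 volume :=
  (memLp_indicator_iff_restrict hJ).2 (Lp.memLp u)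

theorem ae_restrict_zeroExtend (hJ : MeasurableSet J) (u : L2 H J) :
    zeroExtend J u =ᵐ[volume.restrict J] u :=
  indicator_ae_eq_restrict hJ

variable [InnerProductSpace ℂ H]
variable {K : Set ℝ} {c s : ℝ}

/-! ### Elementary functions -/

theorem memLp_smul_const {φ : ℝ → ℂ} (hφ : Continuous φ) (hc : HasCompactSupport φ) (x : H)
    (J : Set ℝ) : MemLp (fun t => φ t • x) 2 (volume.restrict J) := by
  have h : Continuous fun t => φ t • x := by fun_prop
  exact (h.memLp_of_hasCompactSupport hc.smul_right).restrict J

/-- The support of φ may leave J, so this also provides functions with nonzero value at the end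
point. -/
theorem exists_elementaryPair (A : H →ₗ.[ℂ] H) (J : Set ℝ) {φ : ℝ → ℂ} (hφ : ContDiff ℝ ∞ φ)
    (hc : HasCompactSupport φ) (f : A.domain) :
    ∃ p : L2 H J × L2 H J, p.1 =ᵐ[volume.restrict J] (fun t => φ t • (f : H)) ∧
      p.2 =ᵐ[volume.restrict J] (fun t => (Complex.I * deriv φ t) • (f : H) + φ t • A f) := by
  have hd : Continuous (deriv φ) := hφ.continuous_deriv (by simp)
  have h1 := memLp_smul_const hφ.continuous hc (f : H) J
  have h2 := (memLp_smul_const (hd.const_mul Complex.I) hc.deriv.mul_left (f : H) J).add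
    (memLp_smul_const hφ.continuous hc (A f) J)
  exact ⟨(h1.toLp _, h2.toLp _), h1.coeFn_toLp, h2.coeFn_toLp⟩

/-! ### Regularization of weak solutions -/

theorem mollify_zeroExtend_eq [CompleteSpace H] (hJ : MeasurableSet J) (ρ : ℝ → ℝ) (u : L2 H J)
    (t : ℝ) : mollify ρ (zeroExtend J u) t = ∫ r in J, ρ (t - r) • u r := by
  rw [mollify_eq_integral_sub, ← integral_indicator hJ]
  refine integral_congr_ae (Eventually.of_forall fun r => ?_)
  by_cases hr : r ∈ J <;> simp [zeroExtend, hr]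

theorem integrable_kernel_smul {κ : ℝ → ℝ} (hκ : Continuous κ) (hc : HasCompactSupport κ)
    (u : L2 H J) : Integrable (fun r => κ r • u r) (volume.restrict J) := by
  have h1 : MemLp κ 2 (volume.restrict J) := (hκ.memLp_of_hasCompactSupport hc).restrict J
  exact memLp_one_iff_integrable.1 (MemLp.smul (p := 2) (q := 2) (f := u) (φ := κ) (Lp.memLp u) h1)

theorem inner_mollify_zeroExtend [CompleteSpace H] (hJ : MeasurableSet J) {ρ : ℝ → ℝ}
    (hρ : Continuous ρ) (hc : HasCompactSupport ρ) (u : L2 H J) (t : ℝ) (x : H) :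
    inner ℂ x (mollify ρ (zeroExtend J u) t) = ∫ r in J, (ρ (t - r) : ℂ) * inner ℂ x (u r) := by
  have hκ : Continuous fun r => ρ (t - r) := by fun_prop
  have hc' : HasCompactSupport fun r => ρ (t - r) :=
    hc.comp_homeomorph (Homeomorph.subLeft t)
  rw [mollify_zeroExtend_eq hJ, ← integral_inner
    (integrable_kernel_smul hκ hc' u)]
  refine integral_congr_ae (Eventually.of_forall fun r => ?_)
  simp only [← Complex.coe_smul (ρ (t - r)), inner_smul_right]

/-- One-sided mollification turns weak solutions into strong ones. -/
theorem IsWeakPair.isStrongPair_mollify [CompleteSpace H] (hJ : IsHalfLine J K c s)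
    {A : H →ₗ.[ℂ] H} (hA : IsSelfAdjoint A) {u g : L2 H J} (hug : IsWeakPair A J u g)
    {ρ : ℝ → ℝ} (hρ : ContDiff ℝ ∞ ρ) (hc : HasCompactSupport ρ)
    (hs : ∀ x ∈ tsupport ρ, 0 < s * x) :
    IsStrongPair A K (mollify ρ (zeroExtend J u)) (mollify ρ (zeroExtend J g)) := by
  have hm := hJ.isOpen.measurableSet
  refine ⟨mollify (deriv ρ) (zeroExtend J u), fun t ht =>
    ⟨hasDerivAt_mollify hρ hc ((memLp_zeroExtend hm u).locallyIntegrable (by norm_num)) t, ?_⟩⟩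
  have hd : Continuous (deriv ρ) := hρ.continuous_deriv (by simp)
  -- The reflected kernel is an admissible test function even for t = c: since ρ is one-sided, its
  -- support stays in J.
  let φ : ℝ → ℂ := fun r => (ρ (t - r) : ℂ)
  have hφ : ContDiff ℝ ∞ φ :=
    Complex.ofRealCLM.contDiff.comp (hρ.comp (contDiff_const.sub contDiff_id))
  have hts : tsupport φ ⊆ (fun r => t - r) ⁻¹' tsupport ρ := by
    refine closure_minimal (fun r hr => subset_tsupport ρ ?_)
      ((isClosed_tsupport ρ).preimage (by fun_prop))
    intro h
    apply hr
    simp [φ, h]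
  have hφc : HasCompactSupport φ :=
    (hc.comp_homeomorph (Homeomorph.subLeft t)).comp_left (g := ((↑) : ℝ → ℂ)) Complex.ofReal_zero
  have hφJ : tsupport φ ⊆ J := fun r hr => by
    simpa using hJ.shift t ht (t - r) (hs _ (hts hr))
  have hφ' : ∀ r, deriv φ r = -((deriv ρ (t - r) : ℝ) : ℂ) := fun r => by
    have h1 : HasDerivAt ρ (deriv ρ (t - r)) (t - r) :=
      ((hρ.differentiable (by simp)) _).hasDerivAt
    have h2 := (h1.comp_const_sub t r).ofReal_comp
    rw [← Complex.ofReal_neg]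
    exact h2.deriv
  -- Testing the weak equation with φ f, where φ' = -ρ'(t - ·), shows that the value at t pairs with
  -- A f as an element of D(A*) must.
  have key : ∀ f : A.domain, inner ℂ (mollify ρ (zeroExtend J g) t
      - Complex.I • mollify (deriv ρ) (zeroExtend J u) t) (f : H)
      = inner ℂ (mollify ρ (zeroExtend J u) t) (A f) := by
    intro f
    obtain ⟨p, hp1, hp2⟩ := exists_elementaryPair A J hφ hφc f
    have h := hug p ⟨φ, f, hφ, hφc, hφJ, hp1, hp2⟩
    rw [L2.inner_def, L2.inner_def] at h
    have e1 : ∫ r in J, inner ℂ (p.1 r) (g r) = inner ℂ (f : H) (mollify ρ (zeroExtend J g) t) := by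
      rw [inner_mollify_zeroExtend hm hρ.continuous hc]
      refine integral_congr_ae (hp1.mono fun r hr => ?_)
      simp only [hr, inner_smul_left, φ, Complex.conj_ofReal]
    have hI : ∀ (κ : ℝ → ℝ), Continuous κ → HasCompactSupport κ → ∀ x : H,
        Integrable (fun r => (κ (t - r) : ℂ) * inner ℂ x (u r)) (volume.restrict J) := by
      intro κ hκ hκc x
      have := (integrable_kernel_smul (hκ.comp (continuous_const.sub continuous_id))
        (hκc.comp_homeomorph (Homeomorph.subLeft t)) u).const_inner (𝕜 := ℂ) x
      refine this.congr (Eventually.of_forall fun r => ?_)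
      simp [← Complex.coe_smul, inner_smul_right]
    have e2 : ∫ r in J, inner ℂ (p.2 r) (u r)
        = Complex.I * inner ℂ (f : H) (mollify (deriv ρ) (zeroExtend J u) t)
          + inner ℂ (A f) (mollify ρ (zeroExtend J u) t) := by
      rw [inner_mollify_zeroExtend hm hρ.continuous hc, inner_mollify_zeroExtend hm hd hc.deriv,
        ← integral_const_mul, ← integral_add ((hI _ hd hc.deriv _).const_mul _)
          (hI _ hρ.continuous hc _)]
      refine integral_congr_ae (hp2.mono fun r hr => ?_)
      simp only [hr, inner_add_left, inner_smul_left, hφ' r, map_mul, map_neg, Complex.conj_I,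
        Complex.conj_ofReal, φ]
      ring
    rw [e1, e2] at h
    rw [← inner_conj_symm _ (f : H), ← inner_conj_symm _ (A f)]
    congr 1
    rw [inner_sub_right, inner_smul_right, h]
    ring
  have hmem : mollify ρ (zeroExtend J u) t ∈ A†.domain :=
    LinearPMap.mem_adjoint_domain_of_exists _ ⟨_, key⟩
  have happ := LinearPMap.adjoint_apply_eq hA.dense_domain ⟨_, hmem⟩ key
  have hA' : A† = A := hA
  revert hmem
  rw [hA']
  exact fun hmem happ => ⟨hmem, happ⟩

/-- A weak solution is a limit in the graph norm of strong solutions. -/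
theorem IsWeakPair.exists_approx [CompleteSpace H] (hJ : IsHalfLine J K c s)
    {A : H →ₗ.[ℂ] H} (hA : IsSelfAdjoint A) {u g : L2 H J} (hug : IsWeakPair A J u g) :
    ∃ (w h : ℕ → ℝ → H) (U G : ℕ → L2 H J),
      (∀ n, IsStrongPair A K (w n) (h n)) ∧ (∀ n, U n =ᵐ[volume.restrict J] w n) ∧
      (∀ n, G n =ᵐ[volume.restrict J] h n) ∧ Tendsto U atTop (𝓝 u) ∧ Tendsto G atTop (𝓝 g) := by
  have hm := hJ.isOpen.measurableSet
  obtain ⟨ρ, hρ, hc, h0, h1, hsupp, hs⟩ := exists_mollifier hJ.mul_self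
  have key : ∀ u : L2 H J, ∃ U : ℕ → L2 H J,
      (∀ᶠ n in atTop, U n =ᵐ[volume.restrict J] mollify (ρ n) (zeroExtend J u)) ∧
      Tendsto U atTop (𝓝 u) := by
    intro u
    have hF := memLp_zeroExtend hm u
    have ht := tendsto_eLpNorm_mollify_sub (fun n => (hρ n).continuous) hc h0 h1 hsupp
      (stronglyMeasurable_zeroExtend hm u) hF
    have hL : ∀ᶠ n in atTop, MemLp (mollify (ρ n) (zeroExtend J u)) 2 volume :=
      (ht.eventually (gt_mem_nhds ENNReal.zero_lt_top)).mono fun n hn =>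
        memLp_mollify (hρ n) (hc n) hF hn
    classical
    let U : ℕ → L2 H J := fun n =>
      -- Square integrability of the mollification is known only for large n; the value 0 fills the
      -- gap, and a shift of the index by N removes it below.
      if h : MemLp (mollify (ρ n) (zeroExtend J u)) 2 (volume.restrict J) then h.toLp _ else 0
    have hU : ∀ᶠ n in atTop, U n =ᵐ[volume.restrict J] mollify (ρ n) (zeroExtend J u) :=
      hL.mono fun n hn => by
        simp only [U, dif_pos (hn.restrict J)]
        exact (hn.restrict J).coeFn_toLp
    refine ⟨U, hU, ?_⟩
    rw [Lp.tendsto_Lp_iff_tendsto_eLpNorm']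
    refine tendsto_of_tendsto_of_tendsto_of_le_of_le' tendsto_const_nhds ht
      (Eventually.of_forall fun n => zero_le) (hU.mono fun n hn => ?_)
    calc eLpNorm (⇑(U n) - ⇑u) 2 (volume.restrict J)
        = eLpNorm (mollify (ρ n) (zeroExtend J u) - zeroExtend J u) 2 (volume.restrict J) :=
          eLpNorm_congr_ae (hn.sub (ae_restrict_zeroExtend hm u).symm)
      _ ≤ _ := eLpNorm_mono_measure _ Measure.restrict_le_self
  obtain ⟨U, hU, hUt⟩ := key u
  obtain ⟨G, hG, hGt⟩ := key g
  obtain ⟨N, hN⟩ := eventually_atTop.1 (hU.and hG)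
  exact ⟨fun n => mollify (ρ (n + N)) (zeroExtend J u),
    fun n => mollify (ρ (n + N)) (zeroExtend J g),
    fun n => U (n + N), fun n => G (n + N),
    fun n => hug.isStrongPair_mollify hJ hA (hρ _) (hc _) (hs _),
    fun n => (hN _ (Nat.le_add_left N n)).1, fun n => (hN _ (Nat.le_add_left N n)).2,
    hUt.comp (tendsto_add_atTop_nat N), hGt.comp (tendsto_add_atTop_nat N)⟩

end Regularization

section BoundaryValues

variable {H : Type*} [NormedAddCommGroup H] {J K : Set ℝ} {c s : ℝ}

/-! ### Boundary values of weak solutions -/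

/-- `u` has a representative that is continuous on `K` with value `x` at `c`. -/
def HasBoundaryValue (J K : Set ℝ) (c : ℝ) (u : L2 H J) (x : H) : Prop :=
  ∃ v : ℝ → H, ContinuousOn v K ∧ v c = x ∧ u =ᵐ[volume.restrict J] v

/-- Continuous representatives agree on the open set J, hence on its closure, which contains c. -/
theorem HasBoundaryValue.unique (hJ : IsHalfLine J K c s) {u : L2 H J} {x y : H}
    (hx : HasBoundaryValue J K c u x) (hy : HasBoundaryValue J K c u y) : x = y := by
  obtain ⟨v, hv, rfl, h1⟩ := hx
  obtain ⟨w, hw, rfl, h2⟩ := hy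
  have h : EqOn v w J := Measure.eqOn_open_of_ae_eq (h1.symm.trans h2) hJ.isOpen
    (hv.mono hJ.subset) (hw.mono hJ.subset)
  exact h.of_subset_closure hv hw hJ.subset hJ.subset_closure hJ.end_mem

theorem HasBoundaryValue.add {u v : L2 H J} {x y : H}
    (hx : HasBoundaryValue J K c u x) (hy : HasBoundaryValue J K c v y) :
    HasBoundaryValue J K c (u + v) (x + y) := by
  obtain ⟨f, hf, rfl, h1⟩ := hx
  obtain ⟨g, hg, rfl, h2⟩ := hy
  exact ⟨f + g, hf.add hg, rfl, (Lp.coeFn_add u v).trans (h1.add h2)⟩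

variable [InnerProductSpace ℂ H] {A : H →ₗ.[ℂ] H}

theorem _root_.IsSelfAdjoint.isFormalAdjoint_self [CompleteSpace H] (hA : IsSelfAdjoint A) :
    A.IsFormalAdjoint A := by
  have h := LinearPMap.adjoint_isFormalAdjoint hA.dense_domain
  rwa [LinearPMap.isSelfAdjoint_def.1 hA] at h

theorem HasBoundaryValue.smul (r : ℂ) {u : L2 H J} {x : H}
    (hx : HasBoundaryValue J K c u x) : HasBoundaryValue J K c (r • u) (r • x) := by
  obtain ⟨f, hf, rfl, h1⟩ := hx
  exact ⟨r • f, hf.const_smul r, rfl, (Lp.coeFn_smul r u).trans (h1.const_smul r)⟩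

/-- Strong solutions that converge in the graph norm converge uniformly on the closed half-line. -/
theorem exists_boundaryValue_of_tendsto [CompleteSpace H] (hJ : IsHalfLine J K c s)
    (hA : IsSelfAdjoint A) {u g : L2 H J} {w h : ℕ → ℝ → H} {U G : ℕ → L2 H J}
    (hw : ∀ n, IsStrongPair A K (w n) (h n)) (hU : ∀ n, U n =ᵐ[volume.restrict J] w n)
    (hG : ∀ n, G n =ᵐ[volume.restrict J] h n) (hUt : Tendsto U atTop (𝓝 u))
    (hGt : Tendsto G atTop (𝓝 g)) :
    ∃ x, HasBoundaryValue J K c u x ∧ Tendsto (fun n => w n c) atTop (𝓝 x) := by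
  have hdist : ∀ m n, ∀ t ∈ K,
      dist (w m t) (w n t) ^ 2 ≤ dist (U m) (U n) ^ 2 + dist (G m) (G n) ^ 2 := by
    intro m n t ht
    simp only [dist_eq_norm]
    exact ((hw m).sub (hw n)).norm_sq_le hJ hA.isFormalAdjoint_self
      ((Lp.coeFn_sub _ _).trans ((hU m).sub (hU n)))
      ((Lp.coeFn_sub _ _).trans ((hG m).sub (hG n))) ht
  have hcauchy : UniformCauchySeqOn w atTop K := by
    rw [Metric.uniformCauchySeqOn_iff]
    intro ε hε
    obtain ⟨N₁, h₁⟩ := Metric.cauchySeq_iff.1 hUt.cauchySeq (ε / 2) (half_pos hε)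
    obtain ⟨N₂, h₂⟩ := Metric.cauchySeq_iff.1 hGt.cauchySeq (ε / 2) (half_pos hε)
    refine ⟨max N₁ N₂, fun m hm n hn t ht => ?_⟩
    have k₁ := h₁ m (le_of_max_le_left hm) n (le_of_max_le_left hn)
    have k₂ := h₂ m (le_of_max_le_right hm) n (le_of_max_le_right hn)
    have k := hdist m n t ht
    have : dist (w m t) (w n t) ^ 2 < ε ^ 2 := by
      nlinarith [dist_nonneg (x := U m) (y := U n), dist_nonneg (x := G m) (y := G n)]
    exact lt_of_pow_lt_pow_left₀ 2 hε.le this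
  have hlim : ∀ t, ∃ x, t ∈ K → Tendsto (fun n => w n t) atTop (𝓝 x) := by
    intro t
    by_cases ht : t ∈ K
    · obtain ⟨x, hx⟩ := cauchySeq_tendsto_of_complete (hcauchy.cauchySeq ht)
      exact ⟨x, fun _ => hx⟩
    · exact ⟨0, fun h => absurd h ht⟩
  choose v hv using hlim
  have hunif := hcauchy.tendstoUniformlyOn_of_tendsto fun t ht => hv t ht
  have hcont : ContinuousOn v K := hunif.continuousOn <| Frequently.of_forall fun n t ht => by
    obtain ⟨w', hw'⟩ := hw n
    exact (hw' t ht).1.continuousAt.continuousWithinAt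
  refine ⟨v c, ⟨v, hcont, rfl, ?_⟩, hv c hJ.end_mem⟩
  -- A subsequence converges almost everywhere to u, which identifies the uniform limit v with u.
  obtain ⟨k, hk, hae⟩ := (tendstoInMeasure_of_tendsto_Lp hUt).exists_seq_tendsto_ae
  filter_upwards [hae, ae_all_iff.2 hU, ae_restrict_mem hJ.isOpen.measurableSet] with t h1 h2 ht
  refine tendsto_nhds_unique h1 ?_
  simp only [h2]
  exact (hv t (hJ.subset ht)).comp hk.tendsto_atTop

theorem IsWeakPair.exists_boundaryValue [CompleteSpace H] (hJ : IsHalfLine J K c s)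
    (hA : IsSelfAdjoint A) {u g : L2 H J} (h : IsWeakPair A J u g) :
    ∃ x, HasBoundaryValue J K c u x := by
  obtain ⟨w, k, U, G, hw, hU, hG, hUt, hGt⟩ := h.exists_approx hJ hA
  obtain ⟨x, hx, -⟩ := exists_boundaryValue_of_tendsto hJ hA hw hU hG hUt hGt
  exact ⟨x, hx⟩

/-- The Green identity for weak solutions. -/
theorem IsWeakPair.green [CompleteSpace H] (hJ : IsHalfLine J K c s) (hA : IsSelfAdjoint A)
    {u g v l : L2 H J} (hu : IsWeakPair A J u g) (hv : IsWeakPair A J v l) {x y : H}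
    (hx : HasBoundaryValue J K c u x) (hy : HasBoundaryValue J K c v y) :
    inner ℂ v g - inner ℂ l u = s * Complex.I * inner ℂ y x := by
  obtain ⟨w, h, U, G, hw, hU, hG, hUt, hGt⟩ := hu.exists_approx hJ hA
  obtain ⟨w', h', V, L, hw', hV, hL, hVt, hLt⟩ := hv.exists_approx hJ hA
  obtain ⟨x', hx', hxt⟩ := exists_boundaryValue_of_tendsto hJ hA hw hU hG hUt hGt
  obtain ⟨y', hy', hyt⟩ := exists_boundaryValue_of_tendsto hJ hA hw' hV hL hVt hLt
  obtain rfl := hx.unique hJ hx'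
  obtain rfl := hy.unique hJ hy'
  refine tendsto_nhds_unique ((hVt.inner hGt).sub (hLt.inner hUt))
    (((hyt.inner hxt).const_mul _).congr fun n => ?_)
  exact ((hw n).green hJ hA.isFormalAdjoint_self (hw' n) (hU n) (hG n) (hV n) (hL n)).symm

/-- Strong solutions are weak solutions. -/
theorem IsStrongPair.isWeakPair (hJ : IsHalfLine J K c s) (hA : A.IsFormalAdjoint A)
    {w h : ℝ → H} (hw : IsStrongPair A K w h) {U G : L2 H J}
    (hU : U =ᵐ[volume.restrict J] w) (hG : G =ᵐ[volume.restrict J] h) : IsWeakPair A J U G := by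
  rintro p ⟨φ, f, hφ, -, hφJ, h1, h2⟩
  -- A test function vanishes at the end point, so Green's identity has no boundary term.
  have hc : φ c = 0 := image_eq_zero_of_notMem_tsupport fun h => hJ.end_notMem (hφJ h)
  have := hw.green hJ hA (isStrongPair_smul_const hφ f K) hU hG h1 h2
  rw [hc, zero_smul, inner_zero_left, mul_zero] at this
  exact sub_eq_zero.1 this

/-! ### The minimal operator and its adjoint -/

/-- The defining identity is conjugate-linear and continuous in p, so it extends to the closed span.
-/
theorem isWeakPair_iff_closure {u g : L2 H J} : IsWeakPair A J u g ↔
    ∀ p ∈ closure (Submodule.span ℂ (elementaryPairs A J) : Set (L2 H J × L2 H J)),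
      inner ℂ p.1 g = inner ℂ p.2 u := by
  refine ⟨fun h => ?_, fun h p hp => h p (subset_closure (Submodule.subset_span hp))⟩
  refine closure_minimal (fun p hp => ?_)
    (t := {p : L2 H J × L2 H J | inner ℂ p.1 g = inner ℂ p.2 u})
    (isClosed_eq (by fun_prop) (by fun_prop))
  change inner ℂ p.1 g = inner ℂ p.2 u
  induction hp using Submodule.span_induction with
  | mem p hp => exact h p hp
  | zero => simp
  | add p q _ _ hp hq => simp only [Prod.fst_add, Prod.snd_add, inner_add_left, hp, hq]
  | smul r p _ hp => simp only [Prod.smul_fst, Prod.smul_snd, inner_smul_left, hp]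

/-- Elementary pairs are strong, hence weak, solutions. Extending their identity to the closed span
and conjugating exchanges the roles of test pair and solution. -/
theorem isWeakPair_of_mem_closure (hJ : IsHalfLine J K c s) (hA : A.IsFormalAdjoint A)
    {q : L2 H J × L2 H J}
    (hq : q ∈ closure (Submodule.span ℂ (elementaryPairs A J) : Set (L2 H J × L2 H J))) :
    IsWeakPair A J q.1 q.2 := by
  intro p hp
  rw [← inner_conj_symm p.1, ← inner_conj_symm p.2]
  congr 1
  refine (isWeakPair_iff_closure.1 (?_ : IsWeakPair A J p.1 p.2) q hq).symm
  obtain ⟨φ, f, hφ, -, -, h1, h2⟩ := hp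
  exact (isStrongPair_smul_const hφ f K).isWeakPair hJ hA h1 h2

/-- If u is orthogonal to every φ f, then ∫ κ u is orthogonal to the dense set D(A) for each real
test function κ, so it vanishes, and u = 0 by the fundamental lemma of the calculus of variations.
-/
theorem dense_domain_preminimalOperator [CompleteSpace H] (hJ : IsOpen J)
    (hA : Dense (A.domain : Set H)) : Dense ((preminimalOperator A J).domain : Set (L2 H J)) := by
  rw [Submodule.dense_iff_topologicalClosure_eq_top, Submodule.topologicalClosure_eq_top_iff,
    Submodule.eq_bot_iff]
  intro u hu
  have hm := hJ.measurableSet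
  rw [Lp.eq_zero_iff_ae_eq_zero]
  refine (ae_restrict_zeroExtend hm u).symm.trans ((ae_restrict_iff' hm).2 ?_)
  refine hJ.ae_eq_zero_of_integral_contDiff_smul_eq_zero
    (((memLp_zeroExtend hm u).locallyIntegrable (by norm_num)).locallyIntegrableOn J)
    fun κ hκ hκc hκJ => ?_
  have e : ∫ r, κ r • zeroExtend J u r = ∫ r in J, κ r • u r := by
    rw [← integral_indicator hm]
    refine integral_congr_ae (Eventually.of_forall fun r => ?_)
    by_cases hr : r ∈ J <;> simp [zeroExtend, hr]
  rw [e]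
  refine hA.eq_zero_of_inner_right ℂ fun f hf => ?_
  let φ : ℝ → ℂ := fun r => (κ r : ℂ)
  have hφ : ContDiff ℝ ∞ φ := Complex.ofRealCLM.contDiff.comp hκ
  have hφc : HasCompactSupport φ := hκc.comp_left (g := ((↑) : ℝ → ℂ)) Complex.ofReal_zero
  have hφJ : tsupport φ ⊆ J :=
    (closure_mono (s := Function.support φ) (t := Function.support κ)
      fun r hr h => hr (by simp [φ, h])).trans hκJ
  obtain ⟨p, h1, h2⟩ := exists_elementaryPair A J hφ hφc ⟨f, hf⟩
  have hp : p ∈ (preminimalOperator A J).graph := by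
    rw [graph_preminimalOperator A hJ]
    exact Submodule.subset_span ⟨φ, ⟨f, hf⟩, hφ, hφc, hφJ, h1, h2⟩
  have h0 := (Submodule.mem_orthogonal _ _).1 hu p.1 (LinearPMap.mem_domain_of_mem_graph hp)
  rw [L2.inner_def] at h0
  rw [← integral_inner (integrable_kernel_smul hκ.continuous hκc u), ← h0]
  refine integral_congr_ae (h1.mono fun r hr => ?_)
  simp only [hr, φ, ← Complex.coe_smul (κ r), inner_smul_right, inner_smul_left,
    Complex.conj_ofReal]

/-- The preminimal operator is symmetric and densely defined, so its adjoint is a closed extension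
and it is closable. -/
theorem graph_minimalOperator [CompleteSpace H] (hJ : IsHalfLine J K c s) (hA : IsSelfAdjoint A) :
    ((minimalOperator A J).graph : Set (L2 H J × L2 H J))
      = closure (Submodule.span ℂ (elementaryPairs A J) : Set (L2 H J × L2 H J)) ∧
    (minimalOperator A J).IsClosed := by
  have hgraph := graph_preminimalOperator A hJ.isOpen
  have hsymm : (preminimalOperator A J).IsFormalAdjoint (preminimalOperator A J) := by
    intro x y
    have hx := (preminimalOperator A J).mem_graph x
    have hy := (preminimalOperator A J).mem_graph y
    rw [hgraph] at hx hy
    exact (isWeakPair_iff_closure.1 (isWeakPair_of_mem_closure hJ hA.isFormalAdjoint_self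
      (subset_closure hy)) _ (subset_closure hx)).symm
  have hdense := dense_domain_preminimalOperator hJ.isOpen hA.dense_domain
  have hc : (preminimalOperator A J).IsClosable :=
    LinearPMap.isClosable_iff_exists_closed_extension.2
      ⟨_, LinearPMap.adjoint_isClosed hdense, hsymm.le_adjoint hdense⟩
  refine ⟨?_, hc.closure_isClosed⟩
  rw [minimalOperator, ← hc.graph_closure_eq_closure_graph, Submodule.topologicalClosure_coe,
    hgraph]

theorem dense_domain_minimalOperator [CompleteSpace H] (hJ : IsOpen J)
    (hA : Dense (A.domain : Set H)) : Dense ((minimalOperator A J).domain : Set (L2 H J)) :=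
  (dense_domain_preminimalOperator hJ hA).mono (LinearPMap.le_closure _).1

theorem isFormalAdjoint_minimalOperator [CompleteSpace H] (hJ : IsHalfLine J K c s)
    (hA : IsSelfAdjoint A) : (minimalOperator A J).IsFormalAdjoint (minimalOperator A J) := by
  intro x y
  have hx := (minimalOperator A J).mem_graph x
  have hy := (minimalOperator A J).mem_graph y
  rw [← SetLike.mem_coe, (graph_minimalOperator hJ hA).1] at hx hy
  exact (isWeakPair_iff_closure.1 (isWeakPair_of_mem_closure hJ hA.isFormalAdjoint_self hy)
    _ hx).symm

/-- The adjoint of the minimal operator consists of the weak solutions. -/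
theorem mem_graph_adjoint_minimalOperator_iff [CompleteSpace H] (hJ : IsHalfLine J K c s)
    (hA : IsSelfAdjoint A) {u g : L2 H J} :
    (u, g) ∈ (minimalOperator A J)†.graph ↔ IsWeakPair A J u g := by
  have hd := dense_domain_minimalOperator hJ.isOpen hA.dense_domain
  have h := Submodule.mem_adjoint_iff (minimalOperator A J).graph (u, g)
  rw [← LinearPMap.adjoint_graph_eq_graph_adjoint hd] at h
  rw [h, isWeakPair_iff_closure, ← (graph_minimalOperator hJ hA).1]
  exact ⟨fun h p hp => (sub_eq_zero.1 (h p.1 p.2 hp)).symm,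
    fun h p q hpq => sub_eq_zero.2 (h (p, q) hpq).symm⟩

/-- Linearity follows from uniqueness of boundary values. The range contains D(A): take φ x with φ a
bump equal to 1 at c. -/
theorem exists_trace [CompleteSpace H] (hJ : IsHalfLine J K c s) (hA : IsSelfAdjoint A) :
    ∃ τ : (minimalOperator A J)†.domain →ₗ[ℂ] H,
      (∀ (u : (minimalOperator A J)†.domain) (x : H),
        HasBoundaryValue J K c (u : L2 H J) x ↔ x = τ u) ∧
      (∀ u v : (minimalOperator A J)†.domain,
        inner ℂ (v : L2 H J) ((minimalOperator A J)† u)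
          - inner ℂ ((minimalOperator A J)† v) (u : L2 H J)
          = s * Complex.I * inner ℂ (τ v) (τ u)) ∧
      DenseRange τ := by
  set S := minimalOperator A J with hS
  have hweak : ∀ u : S†.domain, IsWeakPair A J u (S† u) := fun u =>
    (mem_graph_adjoint_minimalOperator_iff hJ hA).1 (S†.mem_graph u)
  choose τ hτ using fun u : S†.domain => (hweak u).exists_boundaryValue hJ hA
  refine ⟨⟨⟨τ, fun u v => ?_⟩, fun r u => ?_⟩, fun u x => ⟨fun h => h.unique hJ (hτ u), ?_⟩,
    fun u v => (hweak u).green hJ hA (hweak v) (hτ u) (hτ v), ?_⟩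
  · exact (hτ (u + v)).unique hJ ((hτ u).add (hτ v))
  · exact (hτ (r • u)).unique hJ ((hτ u).smul r)
  · rintro rfl
    exact hτ u
  · refine hA.dense_domain.mono fun x hx => ?_
    let B : ContDiffBump c := ⟨1, 2, one_pos, one_lt_two⟩
    let φ : ℝ → ℂ := fun t => (B t : ℂ)
    have hφ : ContDiff ℝ ∞ φ := Complex.ofRealCLM.contDiff.comp B.contDiff
    have hφc : HasCompactSupport φ :=
      B.hasCompactSupport.comp_left (g := ((↑) : ℝ → ℂ)) Complex.ofReal_zero
    obtain ⟨p, h1, h2⟩ := exists_elementaryPair A J hφ hφc ⟨x, hx⟩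
    have hp := (isStrongPair_smul_const hφ ⟨x, hx⟩ K).isWeakPair hJ hA.isFormalAdjoint_self h1 h2
    rw [← mem_graph_adjoint_minimalOperator_iff hJ hA] at hp
    obtain ⟨u, hu, -⟩ := (LinearPMap.mem_graph_iff _).1 hp
    refine ⟨u, (hτ u).unique hJ ⟨fun t => φ t • x, ?_, ?_, ?_⟩⟩
    · exact (hφ.continuous.smul continuous_const).continuousOn
    · have : B c = 1 := B.one_of_mem_closedBall (by simp [B])
      simp [φ, this]
    · rw [hu]
      exact h1

end BoundaryValues

/-! ### Orthogonal direct sums -/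

section DirectSum

variable {E F : Type*} [NormedAddCommGroup E] [InnerProductSpace ℂ E]
  [NormedAddCommGroup F] [InnerProductSpace ℂ F]

variable {S : E →ₗ.[ℂ] E} {T : F →ₗ.[ℂ] F}

theorem mem_graph_directSum {p : WithLp 2 (E × F) × WithLp 2 (E × F)} :
    p ∈ (directSum S T).graph ↔
      (p.1.fst, p.2.fst) ∈ S.graph ∧ (p.1.snd, p.2.snd) ∈ T.graph := by
  simp only [LinearPMap.mem_graph_iff]
  constructor
  · rintro ⟨x, hx, hx'⟩
    rw [← hx, ← hx']
    exact ⟨⟨⟨_, x.2.1⟩, rfl, rfl⟩, ⟨⟨_, x.2.2⟩, rfl, rfl⟩⟩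
  · rintro ⟨⟨x, hx, hx'⟩, ⟨y, hy, hy'⟩⟩
    have hmem : p.1 ∈ (directSum S T).domain := by
      refine ⟨?_, ?_⟩
      · rw [← hx]; exact x.2
      · rw [← hy]; exact y.2
    refine ⟨⟨p.1, hmem⟩, rfl, ?_⟩
    have e1 : x = ⟨p.1.fst, hmem.1⟩ := Subtype.ext hx
    have e2 : y = ⟨p.1.snd, hmem.2⟩ := Subtype.ext hy
    rw [e1] at hx'
    rw [e2] at hy'
    refine WithLp.ofLp_injective 2 (Prod.ext hx' hy')

theorem isClosed_directSum (hS : S.IsClosed) (hT : T.IsClosed) : (directSum S T).IsClosed := by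
  have h1 : Continuous fun p : WithLp 2 (E × F) × WithLp 2 (E × F) => (p.1.fst, p.2.fst) := by
    fun_prop
  have h2 : Continuous fun p : WithLp 2 (E × F) × WithLp 2 (E × F) => (p.1.snd, p.2.snd) := by
    fun_prop
  have h := (IsClosed.preimage h1 hS).inter (IsClosed.preimage h2 hT)
  change IsClosed ((directSum S T).graph : Set (WithLp 2 (E × F) × WithLp 2 (E × F)))
  convert h using 1
  ext p
  exact mem_graph_directSum

theorem dense_domain_directSum (hS : Dense (S.domain : Set E)) (hT : Dense (T.domain : Set F)) :
    Dense ((directSum S T).domain : Set (WithLp 2 (E × F))) := by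
  refine ((WithLp.toLp_surjective 2).denseRange.dense_image (WithLp.prod_continuous_toLp 2 E F)
    (hS.prod hT)).mono ?_
  rintro _ ⟨p, hp, rfl⟩
  exact hp

theorem isFormalAdjoint_directSum (hS : S.IsFormalAdjoint S) (hT : T.IsFormalAdjoint T) :
    (directSum S T).IsFormalAdjoint (directSum S T) := fun x y => by
  rw [WithLp.prod_inner_apply, WithLp.prod_inner_apply]
  exact congrArg₂ (· + ·) (hS ⟨_, x.2.1⟩ ⟨_, y.2.1⟩) (hT ⟨_, x.2.2⟩ ⟨_, y.2.2⟩)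

/-- The adjoint of a direct sum is the direct sum of the adjoints. -/
theorem adjoint_directSum [CompleteSpace E] [CompleteSpace F]
    (hS : Dense (S.domain : Set E)) (hT : Dense (T.domain : Set F)) :
    (directSum S T)† = directSum S† T† := by
  refine LinearPMap.eq_of_eq_graph ?_
  ext p
  rw [LinearPMap.adjoint_graph_eq_graph_adjoint (dense_domain_directSum hS hT), mem_graph_directSum,
    LinearPMap.adjoint_graph_eq_graph_adjoint hS, LinearPMap.adjoint_graph_eq_graph_adjoint hT,
    Submodule.mem_adjoint_iff, Submodule.mem_adjoint_iff, Submodule.mem_adjoint_iff]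
  constructor
  · intro h
    refine ⟨fun a b hab => ?_, fun a b hab => ?_⟩
    · have := h (WithLp.toLp 2 (a, 0)) (WithLp.toLp 2 (b, 0))
        (mem_graph_directSum.2 ⟨hab, T.graph.zero_mem⟩)
      simpa [WithLp.prod_inner_apply] using this
    · have := h (WithLp.toLp 2 (0, a)) (WithLp.toLp 2 (0, b))
        (mem_graph_directSum.2 ⟨S.graph.zero_mem, hab⟩)
      simpa [WithLp.prod_inner_apply] using this
  · rintro ⟨h1, h2⟩ a b hab
    obtain ⟨k1, k2⟩ := mem_graph_directSum.1 hab
    have e1 := h1 _ _ k1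
    have e2 := h2 _ _ k2
    rw [WithLp.prod_inner_apply, WithLp.prod_inner_apply]
    exact (add_sub_add_comm _ _ _ _).trans ((congrArg₂ (· + ·) e1 e2).trans (add_zero 0))

end DirectSum

/-! ### Symmetric operators with a definite boundary form -/

section BoundaryForm

variable {E H : Type*} [NormedAddCommGroup E] [InnerProductSpace ℂ E] [CompleteSpace E]
  [NormedAddCommGroup H] [InnerProductSpace ℂ H]

/-- For z = ±i, symmetry gives ‖(S - z)x‖² = ‖Sx‖² + ‖x‖². So S - z is bounded below on the graph of
S, which is complete. -/
theorem isClosed_range_sub_smul {S : E →ₗ.[ℂ] E} (hc : S.IsClosed) (hS : S.IsFormalAdjoint S)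
    {z : ℂ} (hz : z.re = 0) (hz1 : ‖z‖ = 1) :
    IsClosed (range fun x : S.domain => S x - z • (x : E)) := by
  have hcompl : CompleteSpace S.graph := IsClosed.completeSpace_coe (hs := hc)
  let T : S.graph →L[ℂ] E :=
    (ContinuousLinearMap.snd ℂ E E - z • ContinuousLinearMap.fst ℂ E E).comp S.graph.subtypeL
  have hT : AntilipschitzWith 1 T := by
    refine AddMonoidHomClass.antilipschitz_of_bound T fun p => ?_
    obtain ⟨x, hx1, hx2⟩ := (LinearPMap.mem_graph_iff _).1 p.2
    have e : T p = S x - z • (x : E) := by rw [hx1, hx2]; rfl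
    have hn : ‖S x - z • (x : E)‖ ^ 2 = ‖S x‖ ^ 2 + ‖(x : E)‖ ^ 2 := by
      rw [norm_sub_sq (𝕜 := ℂ), norm_smul, hz1, one_mul, inner_smul_right]
      have h1 : (inner ℂ (S x) (x : E)).im = 0 := by
        have h := hS x x
        rw [← inner_conj_symm (x : E)] at h
        exact Complex.conj_eq_iff_im.1 h.symm
      have h2 : RCLike.re (z * inner ℂ (S x) (x : E)) = 0 := by
        change (z * inner ℂ (S x) (x : E)).re = 0
        rw [Complex.mul_re, hz, h1]
        ring
      rw [h2]
      ring
    rw [NNReal.coe_one, one_mul]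
    change ‖(p : E × E)‖ ≤ ‖T p‖
    rw [e, Prod.norm_def, ← hx1, ← hx2]
    refine max_le ?_ ?_ <;>
      refine (pow_le_pow_iff_left₀ (norm_nonneg _) (norm_nonneg _) two_ne_zero).1 ?_ <;>
      rw [hn] <;> simp
  have hr := hT.isClosed_range T.uniformContinuous
  convert hr using 1
  ext y
  constructor
  · rintro ⟨x, rfl⟩
    exact ⟨⟨(x, S x), S.mem_graph x⟩, rfl⟩
  · rintro ⟨p, rfl⟩
    obtain ⟨x, hx1, hx2⟩ := (LinearPMap.mem_graph_iff _).1 p.2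
    refine ⟨x, ?_⟩
    simp only [hx1, hx2]
    rfl

variable {S : E →ₗ.[ℂ] E} {τ : S†.domain →ₗ[ℂ] H} {s : ℝ}

/-- Green's identity with v = u reads 2 r i ‖u‖² = s i ‖τ u‖². -/
theorem norm_trace_sq_of_mem_eigenspace (hs : s * s = 1)
    (hgreen : ∀ u v : S†.domain, inner ℂ (v : E) (S† u) - inner ℂ (S† v) (u : E)
      = s * Complex.I * inner ℂ (τ v) (τ u)) {r : ℝ}
    {u : S†.domain} (hu : S† u = (r * Complex.I : ℂ) • (u : E)) :
    ‖τ u‖ ^ 2 = 2 * (s * r) * ‖(u : E)‖ ^ 2 := by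
  have h := hgreen u u
  rw [hu, inner_smul_left, inner_smul_right, inner_self_eq_norm_sq_to_K,
    inner_self_eq_norm_sq_to_K, map_mul, Complex.conj_I, Complex.conj_ofReal] at h
  have hs' : (s : ℂ) * s = 1 := by exact_mod_cast hs
  have h2 : ((‖τ u‖ ^ 2 : ℝ) : ℂ) = ((2 * (s * r) * ‖(u : E)‖ ^ 2 : ℝ) : ℂ) := by
    push_cast
    simp only [Complex.coe_algebraMap] at h
    linear_combination (s : ℂ) * Complex.I * h + (‖τ u‖ : ℂ) ^ 2 * Complex.I ^ 2 * hs'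
      + (‖τ u‖ ^ 2 - 2 * s * r * ‖(u : E)‖ ^ 2 : ℂ) * Complex.I_sq
  exact_mod_cast h2

theorem trace_eq_zero_of_symmetric (hd : Dense (S.domain : Set E)) (hS : S.IsFormalAdjoint S)
    (hs : s * s = 1)
    (hgreen : ∀ u v : S†.domain, inner ℂ (v : E) (S† u) - inner ℂ (S† v) (u : E)
      = s * Complex.I * inner ℂ (τ v) (τ u))
    {u : S†.domain} (hu : (u : E) ∈ S.domain) : τ u = 0 := by
  have hSu : S† u = S ⟨u, hu⟩ := ((hS.le_adjoint hd).2 rfl).symm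
  have h := hgreen u u
  rw [hSu, ← hS ⟨u, hu⟩ ⟨u, hu⟩, sub_self] at h
  have hs0 : (s : ℂ) ≠ 0 := by
    have : s ≠ 0 := fun h => by simp [h] at hs
    exact_mod_cast this
  simpa [hs0, Complex.I_ne_zero] using h.symm

/-- The values of the trace are attained on a deficiency space. -/
theorem exists_eigenvector_trace_eq (hd : Dense (S.domain : Set E)) (hc : S.IsClosed)
    (hS : S.IsFormalAdjoint S) (hs : s * s = 1)
    (hgreen : ∀ u v : S†.domain, inner ℂ (v : E) (S† u) - inner ℂ (S† v) (u : E)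
      = s * Complex.I * inner ℂ (τ v) (τ u)) (v : S†.domain) :
    ∃ u : S†.domain, S† u = (s * Complex.I : ℂ) • (u : E) ∧ τ u = τ v := by
  set z : ℂ := s * Complex.I with hz
  have hs1 := abs_eq_one_of_mul_self_eq_one hs
  let R : Submodule ℂ E := LinearMap.range (S.toFun - z • S.domain.subtype)
  have hR : IsClosed (R : Set E) := by
    have := isClosed_range_sub_smul hc hS (z := z) (by simp [hz])
      (by rw [hz, norm_mul, Complex.norm_real, Real.norm_eq_abs, hs1, Complex.norm_I, one_mul])
    exact this
  -- A vector orthogonal to the range of S - z lies in ker(S* - z̄) = ker(S* + z), where the trace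
  -- identity becomes ‖τ y‖² = -2‖y‖² and forces y = 0.
  have htop : R = ⊤ := by
    have hcompl : CompleteSpace R := IsClosed.completeSpace_coe (hs := hR)
    rw [← Submodule.orthogonal_eq_bot_iff, Submodule.eq_bot_iff]
    intro y hy
    have hy' : ∀ x : S.domain, inner ℂ (star z • y) (x : E) = inner ℂ y (S x) := fun x => by
      have h := (Submodule.mem_orthogonal' _ _).1 hy (S x - z • (x : E)) ⟨x, rfl⟩
      rw [inner_sub_right, inner_smul_right, sub_eq_zero] at h
      rw [inner_smul_left, h]
      simp
    have hmem := LinearPMap.mem_adjoint_domain_of_exists y ⟨_, hy'⟩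
    have happ := LinearPMap.adjoint_apply_eq hd ⟨y, hmem⟩ hy'
    have hz' : star z = ((-s : ℝ) * Complex.I : ℂ) := by simp [hz]
    rw [hz'] at happ
    have hn := norm_trace_sq_of_mem_eigenspace hs hgreen happ
    have : s * -s = -1 := by linarith
    rw [this] at hn
    have h0 : ‖y‖ ^ 2 ≤ 0 := by
      change _ = 2 * -1 * ‖y‖ ^ 2 at hn
      nlinarith [sq_nonneg (‖τ ⟨y, hmem⟩‖)]
    exact norm_eq_zero.1 (pow_eq_zero_iff two_ne_zero |>.1 (le_antisymm h0 (sq_nonneg _)))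
  -- Solving (S - z) w = (S* - z) v puts v - w in ker(S* - z), and w ∈ D(S) has trace 0.
  obtain ⟨w, hw⟩ : S† v - z • (v : E) ∈ R := htop ▸ Submodule.mem_top
  have hw' : S w - z • (w : E) = S† v - z • (v : E) := hw
  have hle := hS.le_adjoint hd
  let w' : S†.domain := ⟨w, hle.1 w.2⟩
  have hSw : S† w' = S w := (hle.2 rfl).symm
  refine ⟨v - w', ?_, ?_⟩
  · rw [LinearPMap.map_sub, hSw]
    change S† v - S w = z • ((v : E) - (w : E))
    rw [smul_sub, ← sub_eq_zero]
    rw [← sub_eq_zero] at hw'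
    rw [← neg_eq_zero, ← hw']
    abel
  · rw [map_sub, trace_eq_zero_of_symmetric hd hS hs hgreen (u := w') w.2, sub_zero]

/-- On ker(S* - s i) the trace multiplies norms by √2. Preimages in this kernel of a sequence
converging to x are therefore Cauchy, and S* is closed. -/
theorem trace_surjective [CompleteSpace H] (hd : Dense (S.domain : Set E)) (hc : S.IsClosed)
    (hS : S.IsFormalAdjoint S) (hs : s * s = 1)
    (hgreen : ∀ u v : S†.domain, inner ℂ (v : E) (S† u) - inner ℂ (S† v) (u : E)
      = s * Complex.I * inner ℂ (τ v) (τ u)) (hτ : DenseRange τ) (x : H) :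
    ∃ u : S†.domain, S† u = (s * Complex.I : ℂ) • (u : E) ∧ τ u = x := by
  obtain ⟨y, hy, hyx⟩ := mem_closure_iff_seq_limit.1 (hτ x)
  have hex : ∀ n, ∃ u : S†.domain, S† u = (s * Complex.I : ℂ) • (u : E) ∧ τ u = y n := fun n => by
    obtain ⟨v, hv⟩ := hy n
    obtain ⟨u, hu, huv⟩ := exists_eigenvector_trace_eq hd hc hS hs hgreen v
    exact ⟨u, hu, huv.trans hv⟩
  choose u hu huy using hex
  have hdist : ∀ a b : S†.domain, S† a = (s * Complex.I : ℂ) • (a : E) →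
      S† b = (s * Complex.I : ℂ) • (b : E) →
      ‖τ a - τ b‖ ^ 2 = 2 * ‖(a : E) - b‖ ^ 2 := fun a b ha hb => by
    have hab : S† (a - b) = (s * Complex.I : ℂ) • ((a - b : S†.domain) : E) := by
      rw [LinearPMap.map_sub, ha, hb, ← smul_sub]
      rfl
    have := norm_trace_sq_of_mem_eigenspace hs hgreen hab
    rw [hs, map_sub, mul_one] at this
    exact this
  have hcau : CauchySeq fun n => (u n : E) := by
    rw [Metric.cauchySeq_iff]
    intro ε hε
    obtain ⟨N, hN⟩ := Metric.cauchySeq_iff.1 hyx.cauchySeq ε hε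
    refine ⟨N, fun m hm n hn => lt_of_le_of_lt ?_ (hN m hm n hn)⟩
    rw [dist_eq_norm, dist_eq_norm, ← huy m, ← huy n]
    have := hdist _ _ (hu m) (hu n)
    refine (pow_le_pow_iff_left₀ (norm_nonneg _) (norm_nonneg _) two_ne_zero).1 ?_
    nlinarith [sq_nonneg ‖(u m : E) - u n‖]
  obtain ⟨v, hv⟩ := cauchySeq_tendsto_of_complete hcau
  have hg : (v, (s * Complex.I : ℂ) • v) ∈ S†.graph := by
    refine (LinearPMap.adjoint_isClosed hd).mem_of_tendsto
      (hv.prodMk_nhds (hv.const_smul (s * Complex.I : ℂ))) (Eventually.of_forall fun n => ?_)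
    rw [← hu n]
    exact S†.mem_graph (u n)
  obtain ⟨v', hv', hSv'⟩ := (LinearPMap.mem_graph_iff _).1 hg
  dsimp only at hv' hSv'
  rw [← hv'] at hSv' hv
  refine ⟨v', hSv', tendsto_nhds_unique ?_ hyx⟩
  rw [tendsto_iff_norm_sub_tendsto_zero] at hv ⊢
  have h2 : Tendsto (fun n => Real.sqrt (2 * ‖(u n : E) - v'‖ ^ 2)) atTop (𝓝 0) := by
    simpa using ((hv.pow 2).const_mul 2).sqrt
  refine Tendsto.congr (fun n => ?_) h2
  rw [← hdist _ _ (hu n) hSv', Real.sqrt_sq (norm_nonneg _), norm_sub_rev, huy, norm_sub_rev]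

end BoundaryForm

theorem boundaryForm_eq {H : Type*} [NormedAddCommGroup H] [InnerProductSpace ℂ H]
    (x y x' y' : H) :
    ((1 : ℝ) * Complex.I * inner ℂ x' x + (-1 : ℝ) * Complex.I * inner ℂ y' y : ℂ)
      = inner ℂ ((1 / (Real.sqrt 2 : ℂ)) • (x' - y')) ((Complex.I / (Real.sqrt 2 : ℂ)) • (x + y))
        - inner ℂ ((Complex.I / (Real.sqrt 2 : ℂ)) • (x' + y'))
          ((1 / (Real.sqrt 2 : ℂ)) • (x - y)) := by
  have hq : ((Real.sqrt 2 : ℝ) : ℂ) ^ 2 = 2 := by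
    rw [← Complex.ofReal_pow, Real.sq_sqrt zero_le_two, Complex.ofReal_ofNat]
  have hq0 : ((Real.sqrt 2 : ℝ) : ℂ) ≠ 0 := fun h => by simp [h] at hq
  simp only [inner_smul_left, inner_smul_right, inner_add_left, inner_add_right,
    inner_sub_left, inner_sub_right, map_div₀, Complex.conj_I, Complex.conj_ofReal, map_one]
  field_simp
  rw [hq]
  push_cast
  ring

/-! ### Deficiency spaces of a direct sum -/

section Deficiency

variable {E F H : Type*} [NormedAddCommGroup E] [InnerProductSpace ℂ E] [CompleteSpace E]
  [NormedAddCommGroup F] [InnerProductSpace ℂ F] [CompleteSpace F]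
  [NormedAddCommGroup H] [InnerProductSpace ℂ H]
  {S : E →ₗ.[ℂ] E} {T : F →ₗ.[ℂ] F}

/-- The coordinate projections of the domain of the adjoint of a direct sum. -/
theorem exists_adjoint_components (hS : Dense (S.domain : Set E))
    (hT : Dense (T.domain : Set F)) :
    ∃ (π₁ : (directSum S T)†.domain →ₗ[ℂ] S†.domain) (π₂ : (directSum S T)†.domain →ₗ[ℂ] T†.domain),
      (∀ u, (π₁ u : E) = (u : WithLp 2 (E × F)).fst ∧ S† (π₁ u) = ((directSum S T)† u).fst) ∧
      (∀ u, (π₂ u : F) = (u : WithLp 2 (E × F)).snd ∧ T† (π₂ u) = ((directSum S T)† u).snd) ∧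
      ∀ x y, ∃ u, π₁ u = x ∧ π₂ u = y := by
  rw [adjoint_directSum hS hT]
  exact ⟨⟨⟨fun u => ⟨_, u.2.1⟩, fun _ _ => rfl⟩, fun _ _ => rfl⟩,
    ⟨⟨fun u => ⟨_, u.2.2⟩, fun _ _ => rfl⟩, fun _ _ => rfl⟩,
    fun u => ⟨rfl, rfl⟩, fun u => ⟨rfl, rfl⟩,
    fun x y => ⟨⟨WithLp.toLp 2 (x, y), x.2, y.2⟩, rfl, rfl⟩⟩

/-- If the boundary forms of `S` and `T` are definite of opposite signs, both deficiency spaces of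
`S ⊕ T` are isometric to the space of boundary values. -/
theorem nonempty_eigenspace_adjoint_directSum_equiv
    {π₁ : (directSum S T)†.domain →ₗ[ℂ] S†.domain} {π₂ : (directSum S T)†.domain →ₗ[ℂ] T†.domain}
    (h₁ : ∀ u, (π₁ u : E) = (u : WithLp 2 (E × F)).fst ∧ S† (π₁ u) = ((directSum S T)† u).fst)
    (h₂ : ∀ u, (π₂ u : F) = (u : WithLp 2 (E × F)).snd ∧ T† (π₂ u) = ((directSum S T)† u).snd)
    (hπ : ∀ x y, ∃ u, π₁ u = x ∧ π₂ u = y)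
    {τ : S†.domain →ₗ[ℂ] H} {σ : T†.domain →ₗ[ℂ] H}
    (hτ : ∀ u v : S†.domain, inner ℂ (v : E) (S† u) - inner ℂ (S† v) (u : E)
      = (1 : ℝ) * Complex.I * inner ℂ (τ v) (τ u))
    (hσ : ∀ u v : T†.domain, inner ℂ (v : F) (T† u) - inner ℂ (T† v) (u : F)
      = (-1 : ℝ) * Complex.I * inner ℂ (σ v) (σ u))
    (hτs : ∀ x, ∃ u : S†.domain, S† u = ((1 : ℝ) * Complex.I : ℂ) • (u : E) ∧ τ u = x)
    (hσs : ∀ x, ∃ u : T†.domain, T† u = ((-1 : ℝ) * Complex.I : ℂ) • (u : F) ∧ σ u = x)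
    {r : ℝ} (hr : r = 1 ∨ r = -1) :
    Nonempty (eigenspace (directSum S T)† (r * Complex.I) ≃ₗᵢ[ℂ] H) := by
  let D := eigenspace (directSum S T)† (r * Complex.I)
  let ι : D →ₗ[ℂ] (directSum S T)†.domain :=
    ⟨⟨fun u => ⟨u, u.2.choose⟩, fun _ _ => rfl⟩, fun _ _ => rfl⟩
  have hι : ∀ u : D, (directSum S T)† (ι u) = (r * Complex.I : ℂ) • (u : WithLp 2 (E × F)) :=
    fun u => u.2.choose_spec
  -- Cancels the factor √2 by which the trace stretches a deficiency space.
  let q : ℂ := ((Real.sqrt 2)⁻¹ : ℝ)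
  let Φ : D →ₗ[ℂ] H := q • (τ ∘ₗ π₁ ∘ₗ ι + σ ∘ₗ π₂ ∘ₗ ι)
  have hnorm : ∀ u : D, ‖Φ u‖ = ‖u‖ := by
    intro u
    have e1 : ‖τ (π₁ (ι u))‖ ^ 2 = 2 * (1 * r) * ‖(u : WithLp 2 (E × F)).fst‖ ^ 2 := by
      have h : S† (π₁ (ι u)) = (r * Complex.I : ℂ) • (π₁ (ι u) : E) := by
        rw [(h₁ _).2, (h₁ _).1, hι]; rfl
      rw [norm_trace_sq_of_mem_eigenspace (by norm_num) hτ h, (h₁ _).1]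
      rfl
    have e2 : ‖σ (π₂ (ι u))‖ ^ 2 = 2 * (-1 * r) * ‖(u : WithLp 2 (E × F)).snd‖ ^ 2 := by
      have h : T† (π₂ (ι u)) = (r * Complex.I : ℂ) • (π₂ (ι u) : F) := by
        rw [(h₂ _).2, (h₂ _).1, hι]; rfl
      rw [norm_trace_sq_of_mem_eigenspace (by norm_num) hσ h, (h₂ _).1]
      rfl
    have hq : ‖q‖ ^ 2 = 1 / 2 := by
      simp [q]
    have hΦ : ‖Φ u‖ ^ 2 = 1 / 2 * ‖τ (π₁ (ι u)) + σ (π₂ (ι u))‖ ^ 2 := by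
      rw [← hq, ← mul_pow, ← norm_smul]
      rfl
    have hu : ‖u‖ ^ 2 = ‖(u : WithLp 2 (E × F)).fst‖ ^ 2 + ‖(u : WithLp 2 (E × F)).snd‖ ^ 2 :=
      WithLp.prod_norm_sq_eq_of_L2 _
    refine (pow_left_inj₀ (norm_nonneg _) (norm_nonneg _) two_ne_zero).1 ?_
    -- For each sign of r, one of `e1`, `e2` equates a square with a nonpositive number, so only one
    -- summand contributes.
    rcases hr with rfl | rfl
    · have h0 : ‖σ (π₂ (ι u))‖ ^ 2 = 0 := by
        nlinarith [sq_nonneg ‖σ (π₂ (ι u))‖, sq_nonneg ‖(u : WithLp 2 (E × F)).snd‖]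
      have h0' : σ (π₂ (ι u)) = 0 := norm_eq_zero.1 (pow_eq_zero_iff two_ne_zero |>.1 h0)
      rw [hΦ, h0', add_zero, e1, hu]
      linarith
    · have h0 : ‖τ (π₁ (ι u))‖ ^ 2 = 0 := by
        nlinarith [sq_nonneg ‖τ (π₁ (ι u))‖, sq_nonneg ‖(u : WithLp 2 (E × F)).fst‖]
      have h0' : τ (π₁ (ι u)) = 0 := norm_eq_zero.1 (pow_eq_zero_iff two_ne_zero |>.1 h0)
      rw [hΦ, h0', zero_add, e2, hu]
      linarith
  have hq0 : q ≠ 0 := by simp [q]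
  have hsurj : Function.Surjective Φ := by
    have key : ∀ (x : S†.domain) (y : T†.domain), S† x = (r * Complex.I : ℂ) • (x : E) →
        T† y = (r * Complex.I : ℂ) • (y : F) → ∃ u : D, Φ u = q • (τ x + σ y) := by
      intro x y hx hy
      obtain ⟨u, rfl, rfl⟩ := hπ x y
      refine ⟨⟨u, u.2, ?_⟩, rfl⟩
      rw [(h₁ u).1, (h₁ u).2] at hx
      rw [(h₂ u).1, (h₂ u).2] at hy
      exact WithLp.ofLp_injective 2 (Prod.ext hx hy)
    intro z
    rcases hr with rfl | rfl
    · obtain ⟨x, hx, hxz⟩ := hτs (q⁻¹ • z)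
      obtain ⟨u, hu⟩ := key x 0 hx (by simp)
      exact ⟨u, by rw [hu, map_zero, add_zero, hxz, smul_inv_smul₀ hq0]⟩
    · obtain ⟨y, hy, hyz⟩ := hσs (q⁻¹ • z)
      obtain ⟨u, hu⟩ := key 0 y (by simp) hy
      exact ⟨u, by rw [hu, map_zero, zero_add, hyz, smul_inv_smul₀ hq0]⟩
  exact ⟨LinearIsometryEquiv.ofSurjective ⟨Φ, hnorm⟩ hsurj⟩

end Deficiency

end MultipointOperator

end

/-! ### The boundary triplet -/

theorem theorem2p1 {H : Type*} [NormedAddCommGroup H] [InnerProductSpace ℂ H] [CompleteSpace H]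
    [TopologicalSpace.SeparableSpace H] (A : H →ₗ.[ℂ] H) (hA : IsSelfAdjoint A)
    (a b : ℝ) (hab : a < b) :
    ∃ τ₁ τ₂ : (MultipointOperator.L₀ A a b)†.domain →ₗ[ℂ] H,
      (∀ (u : (MultipointOperator.L₀ A a b)†.domain) (x : H),
        MultipointOperator.HasLeftBoundaryValue a (u : MultipointOperator.L2Sum H a b).fst x
          ↔ x = τ₁ u) ∧
      (∀ (u : (MultipointOperator.L₀ A a b)†.domain) (x : H),
        MultipointOperator.HasRightBoundaryValue b (u : MultipointOperator.L2Sum H a b).snd x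
          ↔ x = τ₂ u) ∧
      MultipointOperator.IsSpaceOfBoundaryValues (MultipointOperator.L₀ A a b)
        ((Complex.I / (Real.sqrt 2 : ℂ)) • (τ₁ + τ₂))
        ((1 / (Real.sqrt 2 : ℂ)) • (τ₁ - τ₂)) := by
  open MultipointOperator in
  have hJ := isHalfLine_Iio a
  have hK := isHalfLine_Ioi b
  have hJd := dense_domain_minimalOperator hJ.isOpen hA.dense_domain
  have hKd := dense_domain_minimalOperator hK.isOpen hA.dense_domain
  have hJc := (graph_minimalOperator hJ hA).2
  have hKc := (graph_minimalOperator hK hA).2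
  have hJs := isFormalAdjoint_minimalOperator hJ hA
  have hKs := isFormalAdjoint_minimalOperator hK hA
  obtain ⟨τ, hτ, hτg, hτd⟩ := exists_trace hJ hA
  obtain ⟨σ, hσ, hσg, hσd⟩ := exists_trace hK hA
  obtain ⟨π₁, π₂, h₁, h₂, hπ⟩ := exists_adjoint_components hJd hKd
  have hτs := trace_surjective hJd hJc hJs hJ.mul_self hτg hτd
  have hσs := trace_surjective hKd hKc hKs hK.mul_self hσg hσd
  have hdef : ∀ r : ℝ, r = 1 ∨ r = -1 →
      Nonempty (eigenspace (L₀ A a b)† (r * Complex.I) ≃ₗᵢ[ℂ] H) := fun r hr =>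
    nonempty_eigenspace_adjoint_directSum_equiv h₁ h₂ hπ hτg hσg hτs hσs hr
  have hq0 : ((Real.sqrt 2 : ℝ) : ℂ) ≠ 0 := by simp
  refine ⟨τ ∘ₗ π₁, σ ∘ₗ π₂, fun u x => ?_, fun u x => ?_, ?_⟩
  · rw [← (h₁ u).1]
    exact hτ _ x
  · rw [← (h₂ u).1]
    exact hσ _ x
  refine ⟨isClosed_directSum hJc hKc, dense_domain_directSum hJd hKd,
    isFormalAdjoint_directSum hJs hKs, ?_, fun f g => ?_, fun F₁ F₂ => ?_⟩
  · obtain ⟨e₁⟩ := hdef (-1) (Or.inr rfl)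
    obtain ⟨e₂⟩ := hdef 1 (Or.inl rfl)
    rw [Complex.ofReal_neg, Complex.ofReal_one, neg_one_mul] at e₁
    rw [Complex.ofReal_one, one_mul] at e₂
    exact ⟨e₁.trans e₂.symm⟩
  · have k₁ := hτg (π₁ f) (π₁ g)
    have k₂ := hσg (π₂ f) (π₂ g)
    rw [(h₁ f).1, (h₁ g).1, (h₁ f).2, (h₁ g).2] at k₁
    rw [(h₂ f).1, (h₂ g).1, (h₂ f).2, (h₂ g).2] at k₂
    rw [WithLp.prod_inner_apply, WithLp.prod_inner_apply]
    exact (add_sub_add_comm _ _ _ _).trans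
      ((congrArg₂ (· + ·) k₁ k₂).trans (boundaryForm_eq _ _ _ _))
  -- The prescribed values solve u₁(a) + u₂(b) = -i√2 F₁ and u₁(a) - u₂(b) = √2 F₂.
  · obtain ⟨x, -, hx⟩ := hτs (((Real.sqrt 2 : ℂ) / 2) • (F₂ - Complex.I • F₁))
    obtain ⟨y, -, hy⟩ := hσs (((Real.sqrt 2 : ℂ) / 2) • (-Complex.I • F₁ - F₂))
    obtain ⟨u, rfl, rfl⟩ := hπ x y
    refine ⟨u, ?_, ?_⟩
    · change (Complex.I / (Real.sqrt 2 : ℂ)) • (τ (π₁ u) + σ (π₂ u)) = F₁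
      rw [hx, hy, ← smul_add, smul_smul,
        show F₂ - Complex.I • F₁ + (-Complex.I • F₁ - F₂) = (-2 * Complex.I) • F₁ by module,
        smul_smul,
        show Complex.I / (Real.sqrt 2 : ℂ) * ((Real.sqrt 2 : ℂ) / 2) * (-2 * Complex.I) = 1 by
          field_simp; simp, one_smul]
    · change (1 / (Real.sqrt 2 : ℂ)) • (τ (π₁ u) - σ (π₂ u)) = F₂
      rw [hx, hy, ← smul_sub, smul_smul,
        show F₂ - Complex.I • F₁ - (-Complex.I • F₁ - F₂) = (2 : ℂ) • F₂ by module,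
        smul_smul, show 1 / (Real.sqrt 2 : ℂ) * ((Real.sqrt 2 : ℂ) / 2) * 2 = 1 by
          field_simp, one_smul]
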